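/- Let $\Theta,\mathbb Y$ be Polish metric spaces; a measure is called locally finite if it is finite on bounded sets, and $\mathrm{BM}_+(\Theta)$ denotes the bounded measurable functions $f\ge 0$ on $\Theta$ with bounded support. Let $H$ be a locally finite measure on $\Theta$, $\ell$ a $\sigma$-finite measure on $\mathbb Y$, $K_\phi:\mathbb Y\times\Theta\to[0,\infty)$ a measurable kernel, and $\kappa_t\ge 0$ deterministic, $t\ge1$. Let $(W_t)_{t\ge1}$ be a process of locally finite random measures on $\Theta$ that is M-ARG(1), i.e. a Markov process such that, for some $\beta_t,c_t>0$ $(t\ge2)$, for all $t\ge 1$ and $f\in \mathrm{BM}_+(\Theta)$, $$E\big(e^{-\int f\,dW_{t+1}}\mid W_1,\dots,W_t\big)=\exp\Big(-\int_\Theta\log(1+c_{t+1}f)\,dH-\beta_{t+1}\int_\Theta\frac{c_{t+1}f}{1+c_{t+1}f}\,dW_t\Big).$$ Let $(N_t)_{t\ge1}$ be the shot noise process SN-M-ARG(1) driven by it: conditionally on $W_t$, $N_t$ is a Poisson random measure on $\mathbb Y$ with mean measure $\kappa_t\lambda_t(y)\,\ell(dy)$, where $\lambda_t(y)=\int_\Theta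 K_\phi(y,\theta)\,W_t(d\theta)$. Put $\bar W_1=E(W_1(\cdot))$ and assume, for all bounded measurable $B,B_1,B_2\subset\mathbb Y$: (H1) $\int_B K_\phi(y,\theta)\,\ell(dy)<\infty$ for every $\theta$, and $\int_B\int_\Theta K_\phi(y,\theta)\,[H+\bar W_1](d\theta)\,\ell(dy)<\infty$; (H2) $\int_{B_1\times B_2}\int_\Theta K_\phi(y_1,\theta)K_\phi(y_2,\theta)\,[H+\bar W_1](d\theta)\,\ell(dy_1)\ell(dy_2)<\infty$; (H3) $E\big(\int_{B_1\times B_2}\lambda_1(y_1)\lambda_1(y_2)\,\ell(dy_1)\ell(dy_2)\big)<\infty$; (H4) $c_t=c$ and $\beta_t=\beta$ for all $t\ge2$, $\rho=\beta c<1$, and $W_1$ is a gamma random measure with base measure $H$ and rate $(1-\rho)/c$, i.e. $E(e^{-\int f\,dW_1})=\exp\big(-\int_\Theta\log(1+\tfrac{c}{1-\rho}f)\,dH\big)$ for all $f\in \mathrm{BM}_+(\Theta)$. An intensity $\mathfrak D^{(1)}_t$ and a second-order product density $\mathfrak D^{(2)}_t$ of $N_t$ are $[0,\infty]$-valued measurable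 functions such that, for all bounded measurable $B_1,B_2\subset\mathbb Y$, $$E(N_t(B_1))=\int_{B_1}\mathfrak D^{(1)}_t\,d\ell,\qquad E(N_t(B_1)N_t(B_2))=\int_{B_1\cap B_2}\mathfrak D^{(1)}_t\,d\ell+\int_{B_1\times B_2}\mathfrak D^{(2)}_t(y_1,y_2)\,\ell(dy_1)\ell(dy_2).$$ Then, for every $t\ge1$, the functions $\mathfrak D^{(1)}_t(y)=\kappa_tE(\lambda_t(y))$ and $\mathfrak D^{(2)}_t(y_1,y_2)=\kappa_t^2E(\lambda_t(y_1)\lambda_t(y_2))$ are an intensity and a second-order product density of $N_t$; they are finite $\ell$-a.e. and $\ell\otimes\ell$-a.e., respectively; and for all $y,y_1,y_2\in\mathbb Y$ $$\mathfrak D^{(1)}_t(y)=\frac{c\,\kappa_t}{1-\rho}\int_\Theta K_\phi(y,\theta)\,H(d\theta),$$ $$\mathfrak D^{(2)}_t(y_1,y_2)-\mathfrak D^{(1)}_t(y_1)\,\mathfrak D^{(1)}_t(y_2)=\frac{c^2\kappa_t^2}{(1-\rho)^2}\int_\Theta K_\phi(y_1,\theta)K_\phi(y_2,\theta)\,H(d\theta),$$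 the second formula holding literally wherever the subtracted product is finite, and at every $(y_1,y_2)$ as an identity in $[0,\infty]$ once the product is moved to the right-hand side. Any other intensity and second-order product density of $N_t$ are also finite and satisfy the two formulas $\ell$-a.e. and $\ell\otimes\ell$-a.e., respectively. -/

import Mathlib

open MeasureTheory ProbabilityTheory
open scoped ENNReal NNReal

noncomputable section

/-- A measure is locally finite (in the sense used for random measures on metric spaces) if it
gives finite mass to every bounded set. -/
def BoundedlyFinite {E : Type*} [PseudoMetricSpace E] [MeasurableSpace E]
    (μ : Measure E) : Prop :=
  ∀ A : Set E, Bornology.IsBounded A → μ A < ∞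

/-- `BM₊(E)`: measurable, nonnegative, bounded functions with bounded support. -/
structure IsBMPlus {E : Type*} [PseudoMetricSpace E] [MeasurableSpace E] (f : E → ℝ) : Prop where
  measurable : Measurable f
  nonneg : ∀ x, 0 ≤ f x
  bounded : ∃ C : ℝ, ∀ x, f x ≤ C
  bounded_support : Bornology.IsBounded (Function.support f)

/-- A locally finite random measure on `E`, i.e. a measurable map into the space of measures all of
whose values are locally finite. -/
structure IsRandomMeasure {Ω E : Type*} [MeasurableSpace Ω] [PseudoMetricSpace E]
    [MeasurableSpace E] (X : Ω → Measure E) : Prop where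
  measurable : Measurable X
  boundedlyFinite : ∀ ω, BoundedlyFinite (X ω)

/-- Laplace functional of the gamma random measure `GaP(H, b)` with base measure `H` and
inverse scale (rate) `b`. -/
def gammaLaplace {Θ : Type*} [MeasurableSpace Θ] (H : Measure Θ) (b : ℝ) (f : Θ → ℝ) : ℝ :=
  Real.exp (-∫ θ, Real.log (1 + f θ / b) ∂H)

/-- Laplace functional of the noncentral gamma random measure `NcGaP(H, M, c⁻¹)`. -/
def ncGammaLaplace {Θ : Type*} [MeasurableSpace Θ] (H M : Measure Θ) (c : ℝ) (f : Θ → ℝ) : ℝ :=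
  Real.exp (-(∫ θ, Real.log (1 + c * f θ) ∂H) - ∫ θ, c * f θ / (1 + c * f θ) ∂M)

/-- `X ∼ GaP(H, b)` under `P`. -/
structure IsGammaRandomMeasure {Ω Θ : Type*} [MeasurableSpace Ω] [PseudoMetricSpace Θ]
    [MeasurableSpace Θ] (P : Measure Ω) (X : Ω → Measure Θ) (H : Measure Θ) (b : ℝ) : Prop where
  isRandomMeasure : IsRandomMeasure X
  laplace : ∀ f : Θ → ℝ, IsBMPlus f →
    ∫ ω, Real.exp (-∫ θ, f θ ∂(X ω)) ∂P = gammaLaplace H b f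

/-- The `σ`-algebra generated by `W₁, …, W_t`. -/
abbrev pastSigma {Ω Θ : Type*} [MeasurableSpace Θ] (W : ℕ → Ω → Measure Θ) (t : ℕ) :
    MeasurableSpace Ω :=
  ⨆ s ∈ Set.Icc 1 t, MeasurableSpace.comap (W s) inferInstance

/-- `(W_t)_{t ≥ 1}` is a measure-valued autoregressive gamma process `M-ARG(1)` with base measure
`H` and parameters `(β_t, c_t)_{t ≥ 2}`: it is Markov, and the conditional law of `W_{t+1}` given
the past `W₁, …, W_t` is `NcGaP(H, β_{t+1} W_t, c_{t+1}⁻¹)`. Both are expressed by the conditional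
Laplace functional given the whole past. The value `W 0` and the parameters with index `0, 1`
play no role. -/
structure IsMARG1 {Ω Θ : Type*} [MeasurableSpace Ω] [PseudoMetricSpace Θ] [MeasurableSpace Θ]
    (P : Measure Ω) (W : ℕ → Ω → Measure Θ) (H : Measure Θ) (β c : ℕ → ℝ) : Prop where
  base_boundedlyFinite : BoundedlyFinite H
  beta_pos : ∀ t, 2 ≤ t → 0 < β t
  c_pos : ∀ t, 2 ≤ t → 0 < c t
  isRandomMeasure : ∀ t, 1 ≤ t → IsRandomMeasure (W t)
  transition : ∀ t, 1 ≤ t → ∀ f : Θ → ℝ, IsBMPlus f →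
    P[fun ω => Real.exp (-∫ θ, f θ ∂(W (t + 1) ω)) | pastSigma W t] =ᵐ[P]
      fun ω => ncGammaLaplace H (ENNReal.ofReal (β (t + 1)) • W t ω) (c (t + 1)) f

/-- The Poisson distribution of mean `r ∈ [0, ∞]` on `{0, 1, 2, …, ∞}`, the law of mean `∞` being
the Dirac mass at `∞`. -/
def poissonProb (r : ℝ≥0∞) (k : ℕ∞) : ℝ :=
  if r = ∞ then (if k = ⊤ then 1 else 0)
  else if k = ⊤ then 0
  else Real.exp (-r.toReal) * r.toReal ^ k.toNat / (k.toNat.factorial : ℝ)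

/-- Under `P`, conditionally on the `σ`-algebra `m`, the random measure `N` is a Poisson random
measure with (random) mean measure `Λ`: for disjoint measurable `B₁, …, B_n` the variables
`N(B₁), …, N(B_n)` are conditionally independent, and `N(B_i)` is conditionally Poisson with mean
`Λ(B_i)`. -/
structure IsCondPoisson {Ω E : Type*} (m : MeasurableSpace Ω) [mΩ : MeasurableSpace Ω]
    [MeasurableSpace E] (P : Measure[mΩ] Ω) (N Λ : Ω → Measure E) : Prop where
  measurable : Measurable[mΩ] N
  law : ∀ (n : ℕ) (B : Fin n → Set E) (k : Fin n → ℕ∞),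
    (∀ i, MeasurableSet (B i)) → Pairwise (fun i j => Disjoint (B i) (B j)) →
    P[Set.indicator {ω | ∀ i, N ω (B i) = ENat.toENNReal (k i)} (fun _ => (1 : ℝ)) | m] =ᵐ[P]
      fun ω => ∏ i, poissonProb (Λ ω (B i)) (k i)

/-- The shot noise density `y ↦ ∫ K(y, θ) w(dθ)` of a measure `w` on `Θ`. -/
def shotNoise {𝕐 Θ : Type*} [MeasurableSpace Θ] (K : 𝕐 → Θ → ℝ≥0) (w : Measure Θ) (y : 𝕐) :
    ℝ≥0∞ :=
  ∫⁻ θ, (K y θ : ℝ≥0∞) ∂w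

/-- `(N_t)_{t ≥ 1}` is a shot noise measure-valued autoregressive gamma process `SN-M-ARG(1)` driven
by `(W_t)_{t ≥ 1}`: the latter is `M-ARG(1)` and `N_t | W_t ∼ PP(Λ_t)` with
`Λ_t(dy) = κ_t λ_t(y) ℓ(dy)` and `λ_t(y) = ∫ K(y, θ) W_t(dθ)`. -/
structure IsSNMARG1 {Ω 𝕐 Θ : Type*} [MeasurableSpace Ω] [MeasurableSpace 𝕐]
    [PseudoMetricSpace Θ] [MeasurableSpace Θ]
    (P : Measure Ω) (N : ℕ → Ω → Measure 𝕐) (W : ℕ → Ω → Measure Θ) (H : Measure Θ)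
    (β c : ℕ → ℝ) (κ : ℕ → ℝ≥0) (K : 𝕐 → Θ → ℝ≥0) (ℓ : Measure 𝕐) : Prop where
  marg : IsMARG1 P W H β c
  measurable_kernel : Measurable (Function.uncurry K)
  condPoisson : ∀ t, 1 ≤ t →
    IsCondPoisson (MeasurableSpace.comap (W t) inferInstance) P (N t)
      (fun ω => ℓ.withDensity (fun y => (κ t : ℝ≥0∞) * shotNoise K (W t ω) y))

/-- `(H₁)`; here `W₁bar` is the mean measure `E(W₁(·))`. -/
def CondH1 {𝕐 Θ : Type*} [PseudoMetricSpace 𝕐] [MeasurableSpace 𝕐] [MeasurableSpace Θ]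
    (K : 𝕐 → Θ → ℝ≥0) (ℓ : Measure 𝕐) (H W₁bar : Measure Θ) : Prop :=
  ∀ B : Set 𝕐, MeasurableSet B → Bornology.IsBounded B →
    (∀ θ, ∫⁻ y in B, (K y θ : ℝ≥0∞) ∂ℓ < ∞) ∧
    ∫⁻ y in B, ∫⁻ θ, (K y θ : ℝ≥0∞) ∂(H + W₁bar) ∂ℓ < ∞

/-- `(H₂)`; here `W₁bar` is the mean measure `E(W₁(·))`. -/
def CondH2 {𝕐 Θ : Type*} [PseudoMetricSpace 𝕐] [MeasurableSpace 𝕐] [MeasurableSpace Θ]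
    (K : 𝕐 → Θ → ℝ≥0) (ℓ : Measure 𝕐) (H W₁bar : Measure Θ) : Prop :=
  ∀ B₁ B₂ : Set 𝕐, MeasurableSet B₁ → Bornology.IsBounded B₁ →
    MeasurableSet B₂ → Bornology.IsBounded B₂ →
    ∫⁻ p in B₁ ×ˢ B₂, ∫⁻ θ, (K p.1 θ : ℝ≥0∞) * (K p.2 θ : ℝ≥0∞) ∂(H + W₁bar) ∂(ℓ.prod ℓ) < ∞

/-- `(H₃)`. -/
def CondH3 {Ω 𝕐 Θ : Type*} [MeasurableSpace Ω] [PseudoMetricSpace 𝕐] [MeasurableSpace 𝕐]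
    [MeasurableSpace Θ] (P : Measure Ω) (K : 𝕐 → Θ → ℝ≥0) (ℓ : Measure 𝕐)
    (W₁ : Ω → Measure Θ) : Prop :=
  ∀ B₁ B₂ : Set 𝕐, MeasurableSet B₁ → Bornology.IsBounded B₁ →
    MeasurableSet B₂ → Bornology.IsBounded B₂ →
    ∫⁻ ω, ∫⁻ p in B₁ ×ˢ B₂, shotNoise K (W₁ ω) p.1 * shotNoise K (W₁ ω) p.2 ∂(ℓ.prod ℓ) ∂P < ∞

/-- `(H₄)`: time stationarity. -/
structure CondH4 {Ω Θ : Type*} [MeasurableSpace Ω] [PseudoMetricSpace Θ] [MeasurableSpace Θ]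
    (P : Measure Ω) (W₁ : Ω → Measure Θ) (H : Measure Θ) (βs cs : ℕ → ℝ) (β c ρ : ℝ) : Prop where
  beta_const : ∀ t, 2 ≤ t → βs t = β
  c_const : ∀ t, 2 ≤ t → cs t = c
  rho_eq : ρ = β * c
  rho_lt_one : ρ < 1
  init : IsGammaRandomMeasure P W₁ H ((1 - ρ) / c)

/-- `D₁` is an intensity and `D₂` a second-order product density, with respect to `ℓ`, of the random
counting measure `N`: for all bounded measurable `B₁, B₂`,
`E N(B₁) = ∫_{B₁} D₁ dℓ` and
`E N(B₁) N(B₂) = ∫_{B₁ ∩ B₂} D₁ dℓ + ∫_{B₁ × B₂} D₂ d(ℓ ⊗ ℓ)`. -/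
structure AreProductDensities {Ω 𝕐 : Type*} [MeasurableSpace Ω] [PseudoMetricSpace 𝕐]
    [MeasurableSpace 𝕐] (P : Measure Ω) (N : Ω → Measure 𝕐) (ℓ : Measure 𝕐)
    (D₁ : 𝕐 → ℝ≥0∞) (D₂ : 𝕐 → 𝕐 → ℝ≥0∞) : Prop where
  measurable_one : Measurable D₁
  measurable_two : Measurable (Function.uncurry D₂)
  first : ∀ B : Set 𝕐, MeasurableSet B → Bornology.IsBounded B →
    ∫⁻ ω, N ω B ∂P = ∫⁻ y in B, D₁ y ∂ℓ
  second : ∀ B₁ B₂ : Set 𝕐, MeasurableSet B₁ → Bornology.IsBounded B₁ →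
    MeasurableSet B₂ → Bornology.IsBounded B₂ →
    ∫⁻ ω, N ω B₁ * N ω B₂ ∂P =
      ∫⁻ y in B₁ ∩ B₂, D₁ y ∂ℓ + ∫⁻ p in B₁ ×ˢ B₂, D₂ p.1 p.2 ∂(ℓ.prod ℓ)

/-- The pointwise version `y ↦ κ E(λ(y))`, `λ(y) = ∫ K(y, θ) W(dθ)`, of the intensity. -/
def intensity {Ω 𝕐 Θ : Type*} [MeasurableSpace Ω] [MeasurableSpace Θ] (P : Measure Ω)
    (W : Ω → Measure Θ) (κ : ℝ≥0) (K : 𝕐 → Θ → ℝ≥0) (y : 𝕐) : ℝ≥0∞ :=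
  (κ : ℝ≥0∞) * ∫⁻ ω, shotNoise K (W ω) y ∂P

/-- The pointwise version `(y₁, y₂) ↦ κ² E(λ(y₁) λ(y₂))` of the second-order product density. -/
def productDensity {Ω 𝕐 Θ : Type*} [MeasurableSpace Ω] [MeasurableSpace Θ] (P : Measure Ω)
    (W : Ω → Measure Θ) (κ : ℝ≥0) (K : 𝕐 → Θ → ℝ≥0) (y₁ y₂ : 𝕐) : ℝ≥0∞ :=
  (κ : ℝ≥0∞) ^ 2 * ∫⁻ ω, shotNoise K (W ω) y₁ * shotNoise K (W ω) y₂ ∂P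

end

open Filter Topology Asymptotics

/-! Put b = (1 - ρ)/c. The gamma law with base H and rate b is invariant for the M-ARG(1)
transition: with u = cf, one has (1 + u)(1 + b⁻¹βu/(1 + u)) = 1 + u/(1 - ρ), so the transition maps
the Laplace functional of this law to itself. Hence every W_t has the law of W₁
(`IsMARG1.isGammaRandomMeasure`), and only the moments of a single gamma random measure X are
needed.

These moments come from the behaviour of the Laplace functional at 0: E∫h dX = b⁻¹∫h dH and E(∫h dX
∫k dX) = b⁻²(∫h dH ∫k dH + ∫hk dH). They are proved first on `BM₊`, then for all measurable
[0,∞]-valued h, k by monotone approximation (`IsGammaRandomMeasure.lintegral_lintegral`,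
`IsGammaRandomMeasure.lintegral_mul_lintegral`). Taking h = K(y₁,·), k = K(y₂,·) gives both formulas
at every point, with no finiteness assumption; the covariance is the term ∫hk dH.

For the densities, a conditionally Poisson N satisfies E N(A)N(B) = E Λ(A ∩ B) + E Λ(A)Λ(B)
(`IsCondPoisson.lintegral_apply_mul`), and Tonelli turns the right-hand side into integrals of the
pointwise densities. (H1) and (H2) make these integrals finite on bounded sets, which yields
finiteness almost everywhere and almost everywhere uniqueness. -/

/-- An increasing sequence of bounded measurable sets covering a metric space. -/
lemma exists_bounded_exhaustion (E : Type*) [PseudoMetricSpace E] [MeasurableSpace E]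
    [OpensMeasurableSpace E] :
    ∃ s : ℕ → Set E, Monotone s ∧ (∀ n, MeasurableSet (s n)) ∧
      (∀ n, Bornology.IsBounded (s n)) ∧ ⋃ n, s n = Set.univ := by
  rcases isEmpty_or_nonempty E with hE | ⟨⟨x⟩⟩
  · exact ⟨fun _ => ∅, fun _ _ _ => le_rfl, fun _ => .empty, fun _ => Bornology.isBounded_empty,
      Set.eq_univ_of_forall fun x => (hE.false x).elim⟩
  · refine ⟨fun n => Metric.ball x n, fun m n h => Metric.ball_subset_ball (by exact_mod_cast h),
      fun _ => measurableSet_ball, fun _ => Metric.isBounded_ball, Metric.iUnion_ball_nat x⟩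

lemma BoundedlyFinite.sigmaFinite {E : Type*} [PseudoMetricSpace E] [MeasurableSpace E]
    [OpensMeasurableSpace E] {μ : Measure E} (hμ : BoundedlyFinite μ) : SigmaFinite μ := by
  obtain ⟨s, -, -, hb, hu⟩ := exists_bounded_exhaustion E
  exact ⟨⟨⟨s, fun _ => trivial, fun n => hμ _ (hb n), hu⟩⟩⟩

/-! ### Closure properties of the test functions `BM₊`. -/

section BMPlus

variable {E : Type*} [PseudoMetricSpace E] [MeasurableSpace E] {f g : E → ℝ} {μ : Measure E}

/-- Domination by a multiple of a test function transfers both boundedness and bounded support; most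
closure properties reduce to it. -/
lemma IsBMPlus.of_le_mul (hf : IsBMPlus f) {g : E → ℝ} (hg : Measurable g) (hg0 : ∀ x, 0 ≤ g x)
    (C : ℝ) (hgf : ∀ x, g x ≤ C * f x) : IsBMPlus g where
  measurable := hg
  nonneg := hg0
  bounded := by
    obtain ⟨D, hD⟩ := hf.bounded
    refine ⟨|C| * |D|, fun x => (hgf x).trans ?_⟩
    have h1 : f x ≤ |D| := (hD x).trans (le_abs_self D)
    calc C * f x ≤ |C| * f x := mul_le_mul_of_nonneg_right (le_abs_self C) (hf.nonneg x)
      _ ≤ |C| * |D| := mul_le_mul_of_nonneg_left h1 (abs_nonneg C)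
  bounded_support := by
    refine hf.bounded_support.subset fun x hx => ?_
    by_contra h
    have h0 : f x = 0 := by simpa using h
    exact hx (le_antisymm (by simpa [h0] using hgf x) (hg0 x))

lemma IsBMPlus.add (hf : IsBMPlus f) (hg : IsBMPlus g) : IsBMPlus (fun x => f x + g x) where
  measurable := hf.measurable.add hg.measurable
  nonneg x := add_nonneg (hf.nonneg x) (hg.nonneg x)
  bounded := by
    obtain ⟨C, hC⟩ := hf.bounded
    obtain ⟨D, hD⟩ := hg.bounded
    exact ⟨C + D, fun x => add_le_add (hC x) (hD x)⟩
  bounded_support := (hf.bounded_support.union hg.bounded_support).subset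
    (Function.support_add f g)

lemma IsBMPlus.const_mul (hf : IsBMPlus f) {a : ℝ} (ha : 0 ≤ a) :
    IsBMPlus (fun x => a * f x) :=
  hf.of_le_mul (hf.measurable.const_mul a) (fun x => mul_nonneg ha (hf.nonneg x)) a
    fun _ => le_rfl

lemma IsBMPlus.mul (hf : IsBMPlus f) (hg : IsBMPlus g) : IsBMPlus (fun x => f x * g x) := by
  obtain ⟨C, hC⟩ := hf.bounded
  exact hg.of_le_mul (hf.measurable.mul hg.measurable)
    (fun x => mul_nonneg (hf.nonneg x) (hg.nonneg x)) C
    fun x => mul_le_mul_of_nonneg_right (hC x) (hg.nonneg x)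

lemma IsBMPlus.log_one_add (hf : IsBMPlus f) : IsBMPlus (fun x => Real.log (1 + f x)) :=
  hf.of_le_mul (hf.measurable.const_add 1).log
    (fun x => Real.log_nonneg (by linarith [hf.nonneg x])) 1
    fun x => by
      have := hf.nonneg x
      linarith [Real.log_le_sub_one_of_pos (show 0 < 1 + f x by linarith)]

lemma IsBMPlus.integrable [OpensMeasurableSpace E] (hf : IsBMPlus f) (hμ : BoundedlyFinite μ) :
    Integrable f μ := by
  obtain ⟨C, hC⟩ := hf.bounded
  have hs : MeasurableSet (Function.support f) := measurableSet_support hf.measurable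
  rw [← integrableOn_iff_integrable_of_support_subset (le_refl (Function.support f))]
  refine Measure.integrableOn_of_bounded (M := C) (hμ _ hf.bounded_support).ne
    hf.measurable.aestronglyMeasurable (ae_of_all _ fun x => ?_)
  rw [Real.norm_eq_abs, abs_of_nonneg (hf.nonneg x)]
  exact hC x

end BMPlus

/-- Every measurable function with values in `[0, ∞]` is an increasing limit of functions in
`BM₊`. -/
lemma exists_bmPlus_approx {E : Type*} [PseudoMetricSpace E] [MeasurableSpace E]
    [OpensMeasurableSpace E] {h : E → ℝ≥0∞} (hh : Measurable h) :
    ∃ f : ℕ → E → ℝ, (∀ n, IsBMPlus (f n)) ∧ (∀ x, Monotone fun n => ENNReal.ofReal (f n x)) ∧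
      ∀ x, Tendsto (fun n => ENNReal.ofReal (f n x)) atTop (𝓝 (h x)) := by
  obtain ⟨s, hmono, hmeas, hb, hu⟩ := exists_bounded_exhaustion E
  -- Truncation at height n and restriction to `s n`: both increase with n, and every point lies in
  -- `s n` eventually.
  set F : ℕ → E → ℝ≥0∞ := fun n => (s n).indicator fun x => min (h x) n with hF
  have hle : ∀ n x, F n x ≤ n := fun n x =>
    Set.indicator_le_self' (fun _ _ => zero_le) x |>.trans (min_le_right _ _)
  have hofReal : ∀ n x, ENNReal.ofReal (F n x).toReal = F n x := fun n x =>
    ENNReal.ofReal_toReal (ne_top_of_le_ne_top (ENNReal.natCast_ne_top n) (hle n x))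
  refine ⟨fun n x => (F n x).toReal, fun n => ⟨?_, fun x => ENNReal.toReal_nonneg, ⟨n, fun x => ?_⟩,
    (hb n).subset fun x hx => ?_⟩, fun x => ?_, fun x => ?_⟩
  · exact ((hh.min measurable_const).indicator (hmeas n)).ennreal_toReal
  · simpa using ENNReal.toReal_mono (ENNReal.natCast_ne_top n) (hle n x)
  · by_contra hxs
    simp [hF, hxs] at hx
  · simp only [hofReal]
    intro m n hmn
    refine (Set.indicator_le_indicator_of_subset (hmono hmn) (fun _ => zero_le) x).trans ?_
    refine Set.indicator_le_indicator (min_le_min_left _ ?_)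
    exact_mod_cast hmn
  · simp only [hofReal]
    obtain ⟨k, hk⟩ : ∃ k, x ∈ s k := by
      have := hu.symm ▸ Set.mem_univ x
      simpa using this
    have h1 : Tendsto (fun n : ℕ => min (h x) (n : ℝ≥0∞)) atTop (𝓝 (h x)) := by
      have := (tendsto_const_nhds (x := h x)).min ENNReal.tendsto_nat_nhds_top
      simpa using this
    refine h1.congr' ?_
    filter_upwards [eventually_ge_atTop k] with n hn
    simp [hF, hmono hn hk]

/-- Third-order expansion at `0` of the Laplace transform of a unit-rate gamma random measure. -/
lemma gamma_laplace_expansion {E : Type*} [PseudoMetricSpace E] [MeasurableSpace E]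
    [OpensMeasurableSpace E] {H : Measure E} (hH : BoundedlyFinite H) {g : E → ℝ}
    (hg : IsBMPlus g) :
    (fun s : ℝ => Real.exp (-∫ x, Real.log (1 + s * g x) ∂H) -
      (1 - s * ∫ x, g x ∂H + s ^ 2 / 2 * (∫ x, g x * g x ∂H + (∫ x, g x ∂H) ^ 2)))
      =O[𝓝[>] 0] fun s => s ^ 3 := by
  set a := ∫ x, g x ∂H with ha
  set q := ∫ x, g x * g x ∂H with hq
  set φ : ℝ → ℝ := fun s => ∫ x, Real.log (1 + s * g x) ∂H with hφ
  have hid : Tendsto (fun s : ℝ => s) (𝓝[>] 0) (𝓝 0) := nhdsWithin_le_nhds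
  obtain ⟨C, hC⟩ := hg.bounded
  -- Integrated Taylor bound: for 0 ≤ x < 1/2 the error in log(1 + x) ≈ x - x²/2 is at most x³/(1 -
  -- x) ≤ 2x³, whence the constant 2∫g³ dH.
  have hr : (fun s => φ s - (s * a - s ^ 2 / 2 * q)) =O[𝓝[>] 0] fun s => s ^ 3 := by
    refine IsBigO.of_bound (2 * ∫ x, g x * (g x * g x) ∂H) ?_
    have hsmall : ∀ᶠ s : ℝ in 𝓝[>] 0, s * C < 1 / 2 := by
      have : Tendsto (fun s : ℝ => s * C) (𝓝[>] 0) (𝓝 (0 * C)) := hid.mul_const C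
      rw [zero_mul] at this
      exact this.eventually (gt_mem_nhds (by norm_num))
    filter_upwards [self_mem_nhdsWithin, hsmall] with s hs hsC
    have hs0 : (0 : ℝ) < s := hs
    have i1 := (hg.const_mul hs0.le).log_one_add.integrable hH
    have i2 := (hg.integrable hH).const_mul s
    have i3 := ((hg.mul hg).integrable hH).const_mul (s ^ 2 / 2)
    have i4 := ((hg.mul (hg.mul hg)).integrable hH).const_mul (2 * s ^ 3)
    have heq : φ s - (s * a - s ^ 2 / 2 * q) =
        ∫ x, (Real.log (1 + s * g x) - (s * g x - s ^ 2 / 2 * (g x * g x))) ∂H := by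
      have i23 : Integrable (fun x => s * g x - s ^ 2 / 2 * (g x * g x)) H := i2.sub i3
      rw [integral_sub i1 i23, integral_sub i2 i3, integral_const_mul, integral_const_mul]
    rw [heq]
    refine (norm_integral_le_of_norm_le i4 (ae_of_all _ fun x => ?_)).trans ?_
    · have hx0 : 0 ≤ s * g x := mul_nonneg hs0.le (hg.nonneg x)
      have hx1 : s * g x < 1 / 2 := (mul_le_mul_of_nonneg_left (hC x) hs0.le).trans_lt hsC
      have habs : |-(s * g x)| = s * g x := by rw [abs_neg, abs_of_nonneg hx0]
      have := Real.abs_log_sub_add_sum_range_le (x := -(s * g x)) (by rw [habs]; linarith) 2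
      rw [habs] at this
      rw [Real.norm_eq_abs]
      have h2 : (s * g x) ^ 3 / (1 - s * g x) ≤ 2 * s ^ 3 * (g x * (g x * g x)) := by
        rw [div_le_iff₀ (by linarith)]
        have : 0 ≤ (s * g x) ^ 3 := pow_nonneg hx0 3
        nlinarith
      refine le_trans (le_of_eq ?_) (this.trans h2)
      congr 1
      simp [Finset.sum_range_succ]
      ring
    · rw [integral_const_mul, Real.norm_eq_abs, abs_of_pos (pow_pos hs0 3)]
      exact le_of_eq (by ring)
  have hpow : ∀ m n : ℕ, n ≤ m → (fun s : ℝ => s ^ m) =O[𝓝[>] (0 : ℝ)] fun s => s ^ n :=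
    fun m n h => IsBigO.of_bound 1 (by
      filter_upwards [self_mem_nhdsWithin, hid.eventually (gt_mem_nhds one_pos)] with s hs hs1
      have hs0 : (0 : ℝ) < s := hs
      rw [one_mul, norm_pow, norm_pow, Real.norm_of_nonneg hs0.le]
      exact pow_le_pow_of_le_one hs0.le hs1.le h)
  have hconst : ∀ k : ℝ, ∀ n : ℕ, (fun s : ℝ => s ^ n * k) =O[𝓝[>] (0 : ℝ)] fun s => s ^ n :=
    fun k n => by simpa [mul_comm] using (isBigO_refl (fun s : ℝ => s ^ n) (𝓝[>] 0)).const_mul_left k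
  have h2 : (fun s => φ s - s * a) =O[𝓝[>] 0] fun s => s ^ 2 := by
    have := (hr.trans (hpow 3 2 (by norm_num))).sub (hconst (q / 2) 2)
    refine this.congr_left fun s => by ring
  have h1 : φ =O[𝓝[>] 0] fun s => s := by
    have := (h2.trans (hpow 2 1 (by norm_num))).add (hconst a 1)
    refine this.congr (fun s => by ring) fun s => by ring
  have h1' : (fun s => φ s + s * a) =O[𝓝[>] 0] fun s => s := by
    have := h1.add ((hconst a 1).congr_right fun s => pow_one s)
    refine this.congr_left fun s => by ring
  have hφ0 : Tendsto (fun s => -φ s) (𝓝[>] 0) (𝓝 0) := by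
    simpa using (h1.trans_tendsto hid).neg
  have hexp := (Real.exp_sub_sum_range_isBigO_pow 3).comp_tendsto hφ0
  have hexp' : (fun s => Real.exp (-φ s) - (1 - φ s + φ s ^ 2 / 2)) =O[𝓝[>] 0] fun s => s ^ 3 := by
    refine (hexp.trans ((h1.neg_left.pow 3).congr_left fun s => rfl)).congr_left fun s => ?_
    simp [Finset.sum_range_succ, Nat.factorial]
    ring
  -- By difference of squares, φ² may be replaced by (sa)² with an error O(s³).
  have hprod : (fun s => (φ s - s * a) * (φ s + s * a)) =O[𝓝[>] 0] fun s => s ^ 3 :=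
    (h2.mul h1').congr_right fun s => by ring
  refine ((hexp'.sub hr).add (hprod.const_mul_left (1 / 2))).congr_left fun s => ?_
  ring

/-! ### First and second moments of a gamma random measure. -/

section GammaMoments

variable {Ω E : Type*} [MeasurableSpace Ω] [PseudoMetricSpace E] [MeasurableSpace E]
  {P : Measure Ω} {X : Ω → Measure E} {H : Measure E} {b : ℝ}

/-- Moving the rate into the test function as b⁻¹f reduces everything to the unit-rate expansion. -/
lemma IsGammaRandomMeasure.laplace_smul (hX : IsGammaRandomMeasure P X H b) {f : E → ℝ}
    (hf : IsBMPlus f) {s : ℝ} (hs : 0 < s) :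
    ∫ ω, Real.exp (-(s * ∫ x, f x ∂(X ω))) ∂P =
      Real.exp (-∫ x, Real.log (1 + s * (b⁻¹ * f x)) ∂H) := by
  have := hX.laplace _ (hf.const_mul hs.le)
  simp only [gammaLaplace, integral_const_mul] at this
  rw [this]
  congr 3
  funext x
  congr 2
  ring

variable [OpensMeasurableSpace E] [IsProbabilityMeasure P]

lemma IsBMPlus.ofReal_integral {f : E → ℝ} (hf : IsBMPlus f) {μ : Measure E}
    (hμ : BoundedlyFinite μ) : ENNReal.ofReal (∫ x, f x ∂μ) = ∫⁻ x, ENNReal.ofReal (f x) ∂μ :=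
  ofReal_integral_eq_lintegral_ofReal (hf.integrable hμ) (ae_of_all _ hf.nonneg)

lemma IsRandomMeasure.measurable_integral (hX : IsRandomMeasure X) {f : E → ℝ}
    (hf : IsBMPlus f) : Measurable fun ω => ∫ x, f x ∂(X ω) := by
  have : (fun ω => ∫ x, f x ∂(X ω)) = fun ω => (∫⁻ x, ENNReal.ofReal (f x) ∂(X ω)).toReal := by
    funext ω
    rw [← hf.ofReal_integral (hX.boundedlyFinite ω),
      ENNReal.toReal_ofReal (integral_nonneg hf.nonneg)]
  rw [this]
  exact ((Measure.measurable_lintegral hf.measurable.ennreal_ofReal).comp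
    hX.measurable).ennreal_toReal

lemma IsRandomMeasure.integrable_laplace (hX : IsRandomMeasure X) {f : E → ℝ}
    (hf : IsBMPlus f) : Integrable (fun ω => Real.exp (-∫ x, f x ∂(X ω))) P :=
  Integrable.of_bound (hX.measurable_integral hf).neg.exp.aestronglyMeasurable 1
    (ae_of_all _ fun ω => by
      rw [Real.norm_eq_abs, Real.abs_exp, Real.exp_le_one_iff, neg_nonpos]
      exact integral_nonneg hf.nonneg)

/-- If `u n ≤ Z` pointwise, `u n → Z` and the integrals of `u n` converge, then their limit is the
integral of `Z`. -/
lemma lintegral_eq_of_tendsto_of_le {Ω : Type*} [MeasurableSpace Ω] {P : Measure Ω}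
    {u : ℕ → Ω → ℝ≥0∞} {Z : Ω → ℝ≥0∞} {L : ℝ≥0∞}
    (hu : ∀ n, Measurable (u n)) (hle : ∀ n ω, u n ω ≤ Z ω)
    (hlim : ∀ ω, Tendsto (fun n => u n ω) atTop (𝓝 (Z ω)))
    (hL : Tendsto (fun n => ∫⁻ ω, u n ω ∂P) atTop (𝓝 L)) : ∫⁻ ω, Z ω ∂P = L := by
  -- The lower bound is u n ≤ Z; the upper one is Fatou's lemma. No integrability of Z is required,
  -- so moments need not be known finite beforehand.
  refine le_antisymm ?_ (le_of_tendsto' hL fun n => lintegral_mono (hle n))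
  calc ∫⁻ ω, Z ω ∂P = ∫⁻ ω, liminf (fun n => u n ω) atTop ∂P :=
        lintegral_congr fun ω => (hlim ω).liminf_eq.symm
    _ ≤ liminf (fun n => ∫⁻ ω, u n ω ∂P) atTop := lintegral_liminf_le hu
    _ = L := hL.liminf_eq

/-- The quotient (1 - e^{-sx})/s stands in for x: its expectation is read off the Laplace transform,
it lies below x because 1 + v ≤ e^v, and it tends to x as s ↓ 0. -/
lemma one_sub_exp_div_le {s : ℝ} (hs : 0 < s) (x : ℝ) : (1 - Real.exp (-(s * x))) / s ≤ x := by
  rw [div_le_iff₀ hs]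
  linarith [Real.add_one_le_exp (-(s * x))]

lemma one_sub_exp_div_nonneg {s x : ℝ} (hs : 0 < s) (hx : 0 ≤ x) :
    0 ≤ (1 - Real.exp (-(s * x))) / s :=
  div_nonneg (sub_nonneg.2 (Real.exp_le_one_iff.2 (by nlinarith))) hs.le

/-- The limit is the derivative of s ↦ -e^{-sx} at 0. -/
lemma tendsto_one_sub_exp_div (x : ℝ) :
    Tendsto (fun s : ℝ => (1 - Real.exp (-(s * x))) / s) (𝓝[>] 0) (𝓝 x) := by
  have h : HasDerivAt (fun s : ℝ => -Real.exp (-(s * x))) x 0 := by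
    have := (((hasDerivAt_id (0 : ℝ)).mul_const x).neg.exp).neg
    refine (this.congr_deriv (by simp)).congr_of_eventuallyEq (Eventually.of_forall fun s => ?_)
    simp
  have := (hasDerivAt_iff_tendsto_slope_zero.1 h).mono_left
    (nhdsWithin_mono 0 fun s (hs : s ∈ Set.Ioi 0) => (ne_of_gt hs : s ≠ 0))
  refine this.congr fun s => ?_
  simp
  ring

lemma IsRandomMeasure.integrable_laplace_smul (hX : IsRandomMeasure X) {f : E → ℝ}
    (hf : IsBMPlus f) {s : ℝ} (hs : 0 < s) :
    Integrable (fun ω => Real.exp (-(s * ∫ x, f x ∂(X ω)))) P := by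
  have := hX.integrable_laplace (P := P) (hf.const_mul hs.le)
  simpa only [integral_const_mul] using this

lemma exists_seq_tendsto_nhdsGT_zero :
    ∃ s : ℕ → ℝ, (∀ n, 0 < s n) ∧ Tendsto s atTop (𝓝[>] 0) :=
  ⟨fun n => 1 / ((n : ℝ) + 1), fun n => by positivity,
    tendsto_nhdsWithin_iff.2 ⟨tendsto_one_div_add_atTop_nhds_zero_nat,
      Eventually.of_forall fun n => Set.mem_Ioi.2 (by positivity)⟩⟩

/-- With L the Laplace transform along f, the expectation of the quotient is (1 - L(s))/s, whose
limit is the first-order coefficient of the expansion. -/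
lemma IsGammaRandomMeasure.lintegral_ofReal (hX : IsGammaRandomMeasure P X H b) (hb : 0 < b)
    (hH : BoundedlyFinite H) {f : E → ℝ} (hf : IsBMPlus f) :
    ∫⁻ ω, ENNReal.ofReal (∫ x, f x ∂(X ω)) ∂P = ENNReal.ofReal (b⁻¹ * ∫ x, f x ∂H) := by
  have hR := hX.isRandomMeasure
  obtain ⟨s, hs, hs0⟩ := exists_seq_tendsto_nhdsGT_zero
  have hfb := hf.const_mul (inv_nonneg.2 hb.le)
  have hpos : ∀ ω, 0 ≤ ∫ x, f x ∂(X ω) := fun ω => integral_nonneg hf.nonneg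
  refine lintegral_eq_of_tendsto_of_le
    (u := fun n ω => ENNReal.ofReal ((1 - Real.exp (-(s n * ∫ x, f x ∂(X ω)))) / s n))
    (fun n => ?_) (fun n ω => ENNReal.ofReal_le_ofReal (one_sub_exp_div_le (hs n) _))
    (fun ω => ENNReal.tendsto_ofReal ((tendsto_one_sub_exp_div _).comp hs0)) ?_
  · exact ((((hR.measurable_integral hf).const_mul (s n)).neg.exp.const_sub 1).div_const
      _).ennreal_ofReal
  · have hE : ∀ n, ∫⁻ ω, ENNReal.ofReal ((1 - Real.exp (-(s n * ∫ x, f x ∂(X ω)))) / s n) ∂P =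
        ENNReal.ofReal ((1 - Real.exp (-∫ x, Real.log (1 + s n * (b⁻¹ * f x)) ∂H)) / s n) := by
      intro n
      have hi := hR.integrable_laplace_smul (P := P) hf (hs n)
      have hj : Integrable (fun ω => (1 - Real.exp (-(s n * ∫ x, f x ∂(X ω)))) / s n) P :=
        ((integrable_const 1).sub hi).div_const _
      rw [← ofReal_integral_eq_lintegral_ofReal hj
        (ae_of_all _ fun ω => one_sub_exp_div_nonneg (hs n) (hpos ω)), integral_div,
        integral_sub (integrable_const 1) hi, hX.laplace_smul hf (hs n)]
      simp
    simp only [hE]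
    refine ENNReal.tendsto_ofReal (Tendsto.comp (y := 𝓝[>] 0) (g := fun s : ℝ =>
      (1 - Real.exp (-∫ x, Real.log (1 + s * (b⁻¹ * f x)) ∂H)) / s) ?_ hs0)
    have hO := gamma_laplace_expansion hH hfb
    rw [integral_const_mul] at hO
    set a := b⁻¹ * ∫ x, f x ∂H
    set q := ∫ x, b⁻¹ * f x * (b⁻¹ * f x) ∂H
    have hid : Tendsto (fun s : ℝ => s) (𝓝[>] 0) (𝓝 0) := nhdsWithin_le_nhds
    have h0 := (hO.trans_isLittleO (g := fun s : ℝ => s ^ 3) (k := fun s : ℝ => s) ?_)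
      |>.tendsto_div_nhds_zero
    -- Dividing the expansion by s: (1 - L(s))/s is a - (s/2)(q + a²) minus the remainder over s.
    · have h1 : Tendsto (fun s : ℝ => a - s / 2 * (q + a ^ 2)) (𝓝[>] 0)
          (𝓝 (a - 0 / 2 * (q + a ^ 2))) :=
        tendsto_const_nhds.sub ((hid.div_const 2).mul_const _)
      have := h1.sub h0
      rw [zero_div, zero_mul, sub_zero, sub_zero] at this
      refine this.congr' ?_
      filter_upwards [self_mem_nhdsWithin] with s hs
      have hs' : s ≠ 0 := ne_of_gt hs
      field_simp
      ring
    · simpa using (isLittleO_pow_pow (𝕜 := ℝ) (show 1 < 3 by norm_num)).mono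
        (nhdsWithin_le_nhds (s := Set.Ioi (0 : ℝ)))

/-- Polarization: the product of the two quotients has expectation (1 - L_f - L_g + L_{f+g})/s².
Constant and linear terms of the three expansions cancel, and the quadratic ones leave exactly the
cross terms ∫f∫g + ∫fg. -/
lemma IsGammaRandomMeasure.lintegral_ofReal_mul (hX : IsGammaRandomMeasure P X H b) (hb : 0 < b)
    (hH : BoundedlyFinite H) {f g : E → ℝ} (hf : IsBMPlus f) (hg : IsBMPlus g) :
    ∫⁻ ω, ENNReal.ofReal ((∫ x, f x ∂(X ω)) * ∫ x, g x ∂(X ω)) ∂P =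
      ENNReal.ofReal (b⁻¹ ^ 2 * ((∫ x, f x ∂H) * (∫ x, g x ∂H) + ∫ x, f x * g x ∂H)) := by
  have hR := hX.isRandomMeasure
  obtain ⟨s, hs, hs0⟩ := exists_seq_tendsto_nhdsGT_zero
  have hfb := hf.const_mul (inv_nonneg.2 hb.le)
  have hgb := hg.const_mul (inv_nonneg.2 hb.le)
  have hpf : ∀ ω, 0 ≤ ∫ x, f x ∂(X ω) := fun ω => integral_nonneg hf.nonneg
  have hpg : ∀ ω, 0 ≤ ∫ x, g x ∂(X ω) := fun ω => integral_nonneg hg.nonneg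
  refine lintegral_eq_of_tendsto_of_le
    (u := fun n ω => ENNReal.ofReal ((1 - Real.exp (-(s n * ∫ x, f x ∂(X ω)))) / s n *
      ((1 - Real.exp (-(s n * ∫ x, g x ∂(X ω)))) / s n)))
    (fun n => ?_) (fun n ω => ENNReal.ofReal_le_ofReal ?_)
    (fun ω => ENNReal.tendsto_ofReal (((tendsto_one_sub_exp_div _).comp hs0).mul
      ((tendsto_one_sub_exp_div _).comp hs0))) ?_
  · exact (((((hR.measurable_integral hf).const_mul (s n)).neg.exp.const_sub 1).div_const
      _).mul ((((hR.measurable_integral hg).const_mul (s n)).neg.exp.const_sub 1).div_const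
      _)).ennreal_ofReal
  · exact mul_le_mul (one_sub_exp_div_le (hs n) _) (one_sub_exp_div_le (hs n) _)
      (one_sub_exp_div_nonneg (hs n) (hpg ω)) (hpf ω)
  · set L : (E → ℝ) → ℝ → ℝ := fun f s => Real.exp (-∫ x, Real.log (1 + s * (b⁻¹ * f x)) ∂H)
      with hL
    have hE : ∀ n, ∫⁻ ω, ENNReal.ofReal ((1 - Real.exp (-(s n * ∫ x, f x ∂(X ω)))) / s n *
        ((1 - Real.exp (-(s n * ∫ x, g x ∂(X ω)))) / s n)) ∂P =
        ENNReal.ofReal ((1 - L f (s n) - L g (s n) + L (fun x => f x + g x) (s n)) / s n ^ 2) := by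
      intro n
      have hi := hR.integrable_laplace_smul (P := P) hf (hs n)
      have hj := hR.integrable_laplace_smul (P := P) hg (hs n)
      have hk := hR.integrable_laplace_smul (P := P) (hf.add hg) (hs n)
      have hexp : ∀ ω, (1 - Real.exp (-(s n * ∫ x, f x ∂(X ω)))) / s n *
          ((1 - Real.exp (-(s n * ∫ x, g x ∂(X ω)))) / s n) =
          (1 - Real.exp (-(s n * ∫ x, f x ∂(X ω))) - Real.exp (-(s n * ∫ x, g x ∂(X ω))) +
            Real.exp (-(s n * ∫ x, (f x + g x) ∂(X ω)))) / s n ^ 2 := by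
        intro ω
        rw [integral_add (hf.integrable (hR.boundedlyFinite ω))
          (hg.integrable (hR.boundedlyFinite ω)), mul_add, neg_add, Real.exp_add]
        ring
      have hint : Integrable (fun ω => (1 - Real.exp (-(s n * ∫ x, f x ∂(X ω))) -
          Real.exp (-(s n * ∫ x, g x ∂(X ω))) +
            Real.exp (-(s n * ∫ x, (f x + g x) ∂(X ω)))) / s n ^ 2) P :=
        ((((integrable_const 1).sub hi).sub hj).add hk).div_const _
      rw [← ofReal_integral_eq_lintegral_ofReal (hint.congr (ae_of_all _ fun ω => (hexp ω).symm))
        (ae_of_all _ fun ω => mul_nonneg (one_sub_exp_div_nonneg (hs n) (hpf ω))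
          (one_sub_exp_div_nonneg (hs n) (hpg ω)))]
      simp only [hexp]
      have i1 : Integrable (fun ω => 1 - Real.exp (-(s n * ∫ x, f x ∂(X ω)))) P :=
        (integrable_const 1).sub hi
      have i2 : Integrable (fun ω => 1 - Real.exp (-(s n * ∫ x, f x ∂(X ω))) -
          Real.exp (-(s n * ∫ x, g x ∂(X ω)))) P := i1.sub hj
      rw [integral_div, integral_add i2 hk, integral_sub i1 hj,
        integral_sub (integrable_const 1) hi, hX.laplace_smul hf (hs n),
        hX.laplace_smul hg (hs n), hX.laplace_smul (hf.add hg) (hs n)]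
      simp [hL]
    simp only [hE]
    refine ENNReal.tendsto_ofReal (Tendsto.comp (y := 𝓝[>] 0) (g := fun s : ℝ =>
      (1 - L f s - L g s + L (fun x => f x + g x) s) / s ^ 2) ?_ hs0)
    have hOf := gamma_laplace_expansion hH hfb
    have hOg := gamma_laplace_expansion hH hgb
    have hOk := gamma_laplace_expansion hH ((hf.add hg).const_mul (inv_nonneg.2 hb.le))
    have hid : Tendsto (fun s : ℝ => s) (𝓝[>] 0) (𝓝 0) := nhdsWithin_le_nhds
    have hlit : (fun s : ℝ => s ^ 3) =o[𝓝[>] 0] fun s : ℝ => s ^ 2 :=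
      (isLittleO_pow_pow (𝕜 := ℝ) (show 2 < 3 by norm_num)).mono nhdsWithin_le_nhds
    have h0 := (((hOk.sub hOf).sub hOg).trans_isLittleO hlit).tendsto_div_nhds_zero
    have hint : ∀ f g : E → ℝ,
        ∫ x, b⁻¹ * f x * (b⁻¹ * g x) ∂H = b⁻¹ ^ 2 * ∫ x, f x * g x ∂H := by
      intro f g
      rw [← integral_const_mul]
      exact integral_congr_ae (ae_of_all _ fun x => by ring)
    have hadd : ∫ x, (f x + g x) ∂H = ∫ x, f x ∂H + ∫ x, g x ∂H :=
      integral_add (hf.integrable hH) (hg.integrable hH)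
    have hsq : ∫ x, (f x + g x) * (f x + g x) ∂H =
        ∫ x, f x * f x ∂H + 2 * ∫ x, f x * g x ∂H + ∫ x, g x * g x ∂H := by
      have j1 := (hf.mul hf).integrable hH
      have j2 := ((hf.mul hg).integrable hH).const_mul 2
      have j3 := (hg.mul hg).integrable hH
      have j12 : Integrable (fun x => f x * f x + 2 * (f x * g x)) H := j1.add j2
      rw [← integral_const_mul, ← integral_add j1 j2, ← integral_add j12 j3]
      exact integral_congr_ae (ae_of_all _ fun x => by ring)
    rw [hint f f, hint g g, hint (fun x => f x + g x) fun x => f x + g x] at h0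
    simp only [integral_const_mul] at h0
    rw [hadd, hsq] at h0
    have := h0.add_const (b⁻¹ ^ 2 * ((∫ x, f x ∂H) * (∫ x, g x ∂H) + ∫ x, f x * g x ∂H))
    rw [zero_add] at this
    refine this.congr' ?_
    filter_upwards [self_mem_nhdsWithin] with s hs
    have hs' : s ≠ 0 := ne_of_gt hs
    simp only [hL]
    rw [div_add' _ _ _ (pow_ne_zero 2 hs')]
    congr 1
    ring

/-- First moment of a gamma random measure. -/
lemma IsGammaRandomMeasure.lintegral_lintegral (hX : IsGammaRandomMeasure P X H b) (hb : 0 < b)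
    (hH : BoundedlyFinite H) {h : E → ℝ≥0∞} (hh : Measurable h) :
    ∫⁻ ω, ∫⁻ x, h x ∂(X ω) ∂P = ENNReal.ofReal b⁻¹ * ∫⁻ x, h x ∂H := by
  have hR := hX.isRandomMeasure
  obtain ⟨f, hf, hmono, hlim⟩ := exists_bmPlus_approx hh
  have hm : ∀ n, Measurable fun x => ENNReal.ofReal (f n x) :=
    fun n => (hf n).measurable.ennreal_ofReal
  have hconv : ∀ μ : Measure E, Tendsto (fun n => ∫⁻ x, ENNReal.ofReal (f n x) ∂μ) atTop
      (𝓝 (∫⁻ x, h x ∂μ)) := fun μ =>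
    lintegral_tendsto_of_tendsto_of_monotone (fun n => (hm n).aemeasurable)
      (ae_of_all _ hmono) (ae_of_all _ hlim)
  have hmonoI : ∀ μ : Measure E, Monotone fun n => ∫⁻ x, ENNReal.ofReal (f n x) ∂μ :=
    fun μ m n hmn => lintegral_mono fun x => hmono x hmn
  have h1 : Tendsto (fun n => ∫⁻ ω, ∫⁻ x, ENNReal.ofReal (f n x) ∂(X ω) ∂P) atTop
      (𝓝 (∫⁻ ω, ∫⁻ x, h x ∂(X ω) ∂P)) :=
    lintegral_tendsto_of_tendsto_of_monotone
      (fun n => ((Measure.measurable_lintegral (hm n)).comp hR.measurable).aemeasurable)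
      (ae_of_all _ fun ω => hmonoI (X ω)) (ae_of_all _ fun ω => hconv (X ω))
  refine tendsto_nhds_unique h1 (Tendsto.congr (fun n => ?_)
    (ENNReal.Tendsto.const_mul (hconv H) (Or.inr ENNReal.ofReal_ne_top)))
  have := hX.lintegral_ofReal hb hH (hf n)
  rw [ENNReal.ofReal_mul (inv_nonneg.2 hb.le), (hf n).ofReal_integral hH] at this
  rw [← this]
  exact lintegral_congr fun ω => (hf n).ofReal_integral (hR.boundedlyFinite ω)

/-- Second moment of a gamma random measure. -/
lemma IsGammaRandomMeasure.lintegral_mul_lintegral (hX : IsGammaRandomMeasure P X H b)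
    (hb : 0 < b) (hH : BoundedlyFinite H) {h k : E → ℝ≥0∞} (hh : Measurable h)
    (hk : Measurable k) :
    ∫⁻ ω, (∫⁻ x, h x ∂(X ω)) * ∫⁻ x, k x ∂(X ω) ∂P =
      ENNReal.ofReal b⁻¹ ^ 2 * ((∫⁻ x, h x ∂H) * (∫⁻ x, k x ∂H) + ∫⁻ x, h x * k x ∂H) := by
  have hR := hX.isRandomMeasure
  have key : ∀ {f g : E → ℝ}, IsBMPlus f → IsBMPlus g →
      ∫⁻ ω, (∫⁻ x, ENNReal.ofReal (f x) ∂(X ω)) * ∫⁻ x, ENNReal.ofReal (g x) ∂(X ω) ∂P =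
      ENNReal.ofReal b⁻¹ ^ 2 * ((∫⁻ x, ENNReal.ofReal (f x) ∂H) *
        (∫⁻ x, ENNReal.ofReal (g x) ∂H) + ∫⁻ x, ENNReal.ofReal (f x) * ENNReal.ofReal (g x) ∂H) := by
    intro f g hf hg
    have := hX.lintegral_ofReal_mul hb hH hf hg
    have hnf : 0 ≤ ∫ x, f x ∂H := integral_nonneg hf.nonneg
    have hng : 0 ≤ ∫ x, g x ∂H := integral_nonneg hg.nonneg
    rw [ENNReal.ofReal_mul (by positivity), ENNReal.ofReal_pow (inv_nonneg.2 hb.le),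
      ENNReal.ofReal_add (mul_nonneg hnf hng) (integral_nonneg (hf.mul hg).nonneg),
      ENNReal.ofReal_mul hnf, hf.ofReal_integral hH, hg.ofReal_integral hH,
      (hf.mul hg).ofReal_integral hH] at this
    simp only [ENNReal.ofReal_mul (hf.nonneg _)] at this
    rw [← this]
    refine lintegral_congr fun ω => ?_
    rw [ENNReal.ofReal_mul (integral_nonneg hf.nonneg), hf.ofReal_integral (hR.boundedlyFinite ω),
      hg.ofReal_integral (hR.boundedlyFinite ω)]
  obtain ⟨f, hf, hfmono, hflim⟩ := exists_bmPlus_approx hh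
  obtain ⟨g, hg, hgmono, hglim⟩ := exists_bmPlus_approx hk
  have hmf : ∀ n, Measurable fun x => ENNReal.ofReal (f n x) :=
    fun n => (hf n).measurable.ennreal_ofReal
  have hmg : ∀ n, Measurable fun x => ENNReal.ofReal (g n x) :=
    fun n => (hg n).measurable.ennreal_ofReal
  have hsup : ∀ {p : E → ℝ≥0∞} {f : ℕ → E → ℝ}, (∀ x, Monotone fun n => ENNReal.ofReal (f n x)) →
      (∀ x, Tendsto (fun n => ENNReal.ofReal (f n x)) atTop (𝓝 (p x))) →
      p = fun x => ⨆ n, ENNReal.ofReal (f n x) := fun hm hl => funext fun x =>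
    tendsto_nhds_unique (hl x) (tendsto_atTop_iSup (hm x))
  have hf' := hsup hfmono hflim
  have hg' := hsup hgmono hglim
  have If : ∀ μ : Measure E, ∫⁻ x, h x ∂μ = ⨆ n, ∫⁻ x, ENNReal.ofReal (f n x) ∂μ := fun μ => by
    rw [hf']; exact lintegral_iSup hmf fun m n hmn x => hfmono x hmn
  have Ig : ∀ μ : Measure E, ∫⁻ x, k x ∂μ = ⨆ n, ∫⁻ x, ENNReal.ofReal (g n x) ∂μ := fun μ => by
    rw [hg']; exact lintegral_iSup hmg fun m n hmn x => hgmono x hmn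
  have mf : ∀ μ : Measure E, Monotone fun n => ∫⁻ x, ENNReal.ofReal (f n x) ∂μ :=
    fun μ m n hmn => lintegral_mono fun x => hfmono x hmn
  have mg : ∀ μ : Measure E, Monotone fun n => ∫⁻ x, ENNReal.ofReal (g n x) ∂μ :=
    fun μ m n hmn => lintegral_mono fun x => hgmono x hmn
  -- Multiplication on [0,∞] is not continuous at (0,∞), so limits of products are handled as
  -- suprema: multiplication commutes with these unconditionally, and monotonicity reduces the
  -- double supremum to the diagonal.
  have diag : ∀ {u v : ℕ → ℝ≥0∞}, Monotone u → Monotone v →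
      (⨆ n, u n) * (⨆ n, v n) = ⨆ n, u n * v n := fun {u v} hu hv => by
    refine tendsto_nhds_unique ?_ (tendsto_atTop_iSup (f := fun n => u n * v n)
      fun m n hmn => mul_le_mul' (hu hmn) (hv hmn))
    rw [ENNReal.iSup_mul]
    simp only [ENNReal.mul_iSup]
    have : ⨆ i, ⨆ j, u i * v j = ⨆ n, u n * v n := by
      refine le_antisymm (iSup₂_le fun i j => ?_) (iSup_le fun n => le_iSup₂_of_le n n le_rfl)
      exact le_iSup_of_le (max i j)
        (mul_le_mul' (hu (le_max_left i j)) (hv (le_max_right i j)))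
    rw [this]
    exact tendsto_atTop_iSup fun m n hmn => mul_le_mul' (hu hmn) (hv hmn)
  have hprod : ∫⁻ x, h x * k x ∂H =
      ⨆ n, ∫⁻ x, ENNReal.ofReal (f n x) * ENNReal.ofReal (g n x) ∂H := by
    have hm : ∀ n, Measurable fun x => ENNReal.ofReal (f n x) * ENNReal.ofReal (g n x) :=
      fun n => (hmf n).mul (hmg n)
    rw [← lintegral_iSup hm
      fun m n hmn x => mul_le_mul' (hfmono x hmn) (hgmono x hmn)]
    refine lintegral_congr fun x => ?_
    rw [hf', hg']
    exact diag (hfmono x) (hgmono x)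
  have mprod : Monotone fun n => ∫⁻ x, ENNReal.ofReal (f n x) * ENNReal.ofReal (g n x) ∂H :=
    fun m n hmn => lintegral_mono fun x => mul_le_mul' (hfmono x hmn) (hgmono x hmn)
  have hleft : ∫⁻ ω, (∫⁻ x, h x ∂(X ω)) * ∫⁻ x, k x ∂(X ω) ∂P =
      ⨆ n, ∫⁻ ω, (∫⁻ x, ENNReal.ofReal (f n x) ∂(X ω)) * ∫⁻ x, ENNReal.ofReal (g n x) ∂(X ω) ∂P := by
    have hm : ∀ n, Measurable fun ω => (∫⁻ x, ENNReal.ofReal (f n x) ∂(X ω)) *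
        ∫⁻ x, ENNReal.ofReal (g n x) ∂(X ω) :=
      fun n => ((Measure.measurable_lintegral (hmf n)).comp hR.measurable).mul
        ((Measure.measurable_lintegral (hmg n)).comp hR.measurable)
    rw [← lintegral_iSup hm
      fun m n hmn ω => mul_le_mul' (mf (X ω) hmn) (mg (X ω) hmn)]
    refine lintegral_congr fun ω => ?_
    rw [If, Ig, diag (mf _) (mg _)]
  rw [hleft, If, Ig, diag (mf H) (mg H), hprod, ENNReal.iSup_add_iSup_of_monotone
    (fun m n hmn => mul_le_mul' (mf H hmn) (mg H hmn)) mprod, ENNReal.mul_iSup]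
  exact iSup_congr fun n => key (hf n) (hg n)

end GammaMoments

/-! ### Stationarity of the driving process. -/

lemma pastSigma_le {Ω Θ : Type*} [mΩ : MeasurableSpace Ω] [MeasurableSpace Θ]
    {W : ℕ → Ω → Measure Θ} {t : ℕ} (hW : ∀ s, 1 ≤ s → Measurable (W s)) :
    pastSigma W t ≤ mΩ :=
  iSup₂_le fun s hs => (hW s hs.1).comap_le

/-- Under the stationarity condition every `W_t` is the same gamma random measure. -/
lemma IsMARG1.isGammaRandomMeasure {Ω Θ : Type*} [MeasurableSpace Ω] [PseudoMetricSpace Θ]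
    [MeasurableSpace Θ] [OpensMeasurableSpace Θ] {P : Measure Ω} [IsProbabilityMeasure P]
    {W : ℕ → Ω → Measure Θ} {H : Measure Θ} {βs cs : ℕ → ℝ} {β c ρ : ℝ}
    (hW : IsMARG1 P W H βs cs) (h4 : CondH4 P (W 1) H βs cs β c ρ) {t : ℕ} (ht : 1 ≤ t) :
    IsGammaRandomMeasure P (W t) H ((1 - ρ) / c) := by
  have hβ : 0 < β := h4.beta_const 2 le_rfl ▸ hW.beta_pos 2 le_rfl
  have hc : 0 < c := h4.c_const 2 le_rfl ▸ hW.c_pos 2 le_rfl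
  have hρ : 0 < 1 - ρ := sub_pos.2 h4.rho_lt_one
  induction t, ht using Nat.le_induction with
  | base => exact h4.init
  | succ t ht ih =>
    refine ⟨hW.isRandomMeasure _ (by lia), fun f hf => ?_⟩
    have hcf := hf.const_mul hc.le
    have hfrac : IsBMPlus fun x => c * f x / (1 + c * f x) :=
      hcf.of_le_mul (hcf.measurable.div (hcf.measurable.const_add 1))
        (fun x => div_nonneg (hcf.nonneg x) (by linarith [hcf.nonneg x])) 1 fun x => by
          rw [one_mul]
          exact div_le_self (hcf.nonneg x) (by linarith [hcf.nonneg x])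
    have hg := hfrac.const_mul hβ.le
    have hnc : ∀ ω, ncGammaLaplace H (ENNReal.ofReal (βs (t + 1)) • W t ω) (cs (t + 1)) f =
        Real.exp (-∫ x, Real.log (1 + c * f x) ∂H) *
          Real.exp (-∫ x, β * (c * f x / (1 + c * f x)) ∂(W t ω)) := fun ω => by
      rw [ncGammaLaplace, h4.beta_const _ (by lia), h4.c_const _ (by lia),
        integral_smul_measure, ENNReal.toReal_ofReal hβ.le, integral_const_mul, sub_eq_add_neg,
        Real.exp_add, smul_eq_mul]
    have hm := pastSigma_le (t := t) fun s hs => (hW.isRandomMeasure s hs).measurable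
    -- Tower property: the transition leaves a deterministic factor times the Laplace functional of
    -- W_t at βcf/(1 + cf), to which the induction hypothesis applies.
    rw [← integral_condExp hm, integral_congr_ae (hW.transition t ht f hf)]
    simp only [hnc]
    -- Invariance of the gamma law: pointwise, with u = cf and ρ = βc, (1 + u)(1 + ρu/((1 + u)(1 -
    -- ρ))) = 1 + u/(1 - ρ).
    have hsum : ∫ x, Real.log (1 + f x / ((1 - ρ) / c)) ∂H = ∫ x, Real.log (1 + c * f x) ∂H +
        ∫ x, Real.log (1 + β * (c * f x / (1 + c * f x)) / ((1 - ρ) / c)) ∂H := by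
      have hi := (hg.const_mul (inv_nonneg.2 (div_pos hρ hc).le)).log_one_add.integrable
        hW.base_boundedlyFinite
      simp only [inv_mul_eq_div] at hi
      rw [← integral_add (hcf.log_one_add.integrable hW.base_boundedlyFinite) hi]
      refine integral_congr_ae (ae_of_all _ fun x => ?_)
      have h0 : 0 ≤ c * f x := hcf.nonneg x
      have h1 : 0 < 1 + c * f x := by linarith
      have h2 : 0 ≤ β * (c * f x / (1 + c * f x)) / ((1 - ρ) / c) :=
        div_nonneg (hg.nonneg x) (div_pos hρ hc).le
      simp only
      rw [← Real.log_mul h1.ne' (by linarith)]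
      congr 1
      have hρ' : 1 - c * β ≠ 0 := by
        rw [mul_comm, ← h4.rho_eq]
        exact hρ.ne'
      obtain ⟨u, hu⟩ : ∃ u, u = c * f x := ⟨_, rfl⟩
      have hfx : f x = u / c := by rw [hu, mul_div_cancel_left₀ _ hc.ne']
      rw [← hu] at h1 ⊢
      have h3 := h1.ne'
      rw [hfx, h4.rho_eq]
      field_simp
      ring
    rw [integral_const_mul, ih.laplace _ hg, gammaLaplace, gammaLaplace, ← Real.exp_add, hsum,
      neg_add]

/-! ### Moments of Poisson laws on {0, 1, …, ∞} and of conditionally Poisson measures. -/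

section Poisson

/-- Separates the atom at ∞, which carries the whole Poisson law of infinite mean, from the usual
series over ℕ. -/
lemma ENNReal.tsum_enat (f : ℕ∞ → ℝ≥0∞) : ∑' k, f k = f ⊤ + ∑' n : ℕ, f n := by
  change ∑' k : Option ℕ, f k = _
  rw [← (Equiv.optionEquivSumPUnit.{0} ℕ).symm.tsum_eq (f : Option ℕ → ℝ≥0∞),
    Summable.tsum_sum ENNReal.summable ENNReal.summable, add_comm]
  simp
  rfl

lemma poissonProb_nonneg (r : ℝ≥0∞) (k : ℕ∞) : 0 ≤ poissonProb r k := by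
  unfold poissonProb
  split_ifs <;> positivity

lemma poissonProb_coe_natCast (r : ℝ≥0) (n : ℕ) :
    poissonProb r n = Real.exp (-r) * r ^ n / (n.factorial : ℝ) := by simp [poissonProb]

/-- The recursion (n + 1)p_{n+1} = r p_n lowers the order of a moment by an index shift; both
Poisson moments follow from it. -/
lemma natCast_succ_mul_poissonProb (r : ℝ≥0) (n : ℕ) :
    ((n + 1 : ℕ) : ℝ≥0∞) * ENNReal.ofReal (poissonProb r (n + 1 : ℕ)) =
      r * ENNReal.ofReal (poissonProb r n) := by
  rw [poissonProb_coe_natCast, poissonProb_coe_natCast, ← ENNReal.ofReal_natCast,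
    ← ENNReal.ofReal_coe_nnreal, ← ENNReal.ofReal_mul (by positivity),
    ← ENNReal.ofReal_mul (by positivity), Nat.factorial_succ]
  congr 1
  push_cast
  field_simp
  ring

lemma tsum_poissonProb_coe (r : ℝ≥0) : ∑' n : ℕ, ENNReal.ofReal (poissonProb r n) = 1 := by
  have h := hasSum_one_poissonMeasure r
  simp only [poissonProb_coe_natCast]
  rw [← ENNReal.ofReal_tsum_of_nonneg (fun n => by positivity) h.summable, h.tsum_eq,
    ENNReal.ofReal_one]

lemma tsum_natCast_mul_poissonProb_coe (r : ℝ≥0) :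
    ∑' n : ℕ, (n : ℝ≥0∞) * ENNReal.ofReal (poissonProb r n) = r := by
  rw [tsum_eq_zero_add' ENNReal.summable]
  simp only [natCast_succ_mul_poissonProb, ENNReal.tsum_mul_left, tsum_poissonProb_coe]
  simp

lemma tsum_poissonProb (r : ℝ≥0∞) : ∑' k, ENNReal.ofReal (poissonProb r k) = 1 := by
  rw [ENNReal.tsum_enat]
  induction r with
  | top => simp [poissonProb]
  | coe r =>
    have h : poissonProb r ⊤ = 0 := by simp [poissonProb]
    simp [tsum_poissonProb_coe, h]

/-- Mean of the Poisson distribution. -/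
lemma tsum_mul_poissonProb (r : ℝ≥0∞) :
    ∑' k : ℕ∞, (k : ℝ≥0∞) * ENNReal.ofReal (poissonProb r k) = r := by
  rw [ENNReal.tsum_enat]
  induction r with
  | top => simp [poissonProb]
  | coe r =>
    have h : poissonProb r ⊤ = 0 := by simp [poissonProb]
    simp [tsum_natCast_mul_poissonProb_coe, h]

/-- Second moment of the Poisson distribution. -/
lemma tsum_sq_mul_poissonProb (r : ℝ≥0∞) :
    ∑' k : ℕ∞, ((k : ℝ≥0∞) * k) * ENNReal.ofReal (poissonProb r k) = r + r * r := by
  rw [ENNReal.tsum_enat]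
  induction r with
  | top => simp [poissonProb]
  | coe r =>
    have h : poissonProb r ⊤ = 0 := by simp [poissonProb]
    rw [h, ENNReal.ofReal_zero, mul_zero, zero_add, tsum_eq_zero_add' ENNReal.summable]
    simp only [ENat.toENNReal_coe, mul_assoc, natCast_succ_mul_poissonProb]
    -- One factor n + 1 has been absorbed by the recursion; splitting the other as n + 1 leaves
    -- r(mean + total mass) = r(r + 1).
    have h2 : ∀ n : ℕ, ((n + 1 : ℕ) : ℝ≥0∞) * (r * ENNReal.ofReal (poissonProb r n)) =
        r * (n * ENNReal.ofReal (poissonProb r n) + ENNReal.ofReal (poissonProb r n)) := by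
      intro n; push_cast; ring
    simp only [h2, ENNReal.tsum_mul_left]
    rw [ENNReal.tsum_add, tsum_natCast_mul_poissonProb_coe, tsum_poissonProb_coe]
    simp
    ring

lemma pairwise_disjoint_apply_eq {Ω E : Type*} [MeasurableSpace E]
    (N : Ω → Measure E) (B : Set E) :
    Pairwise (Function.onFun Disjoint fun k : ℕ∞ => {ω | N ω B = k}) := by
  intro j k hjk
  refine Set.disjoint_left.2 fun ω (hj : _ = _) (hk : _ = _) => hjk ?_
  exact ENat.toENNReal_inj.1 (hj.symm.trans hk)

variable {Ω E : Type*} {m : MeasurableSpace Ω} [mΩ : MeasurableSpace Ω] [MeasurableSpace E]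
  {P : Measure Ω} {N Λ : Ω → Measure E}

lemma IsCondPoisson.measurable_apply (h : IsCondPoisson m P N Λ) {B : Set E}
    (hB : MeasurableSet B) : Measurable fun ω => N ω B :=
  (Measure.measurable_coe hB).comp h.measurable

lemma IsCondPoisson.measurableSet_eq (h : IsCondPoisson m P N Λ) {n : ℕ} {B : Fin n → Set E}
    (hB : ∀ i, MeasurableSet (B i)) (k : Fin n → ℕ∞) :
    MeasurableSet {ω | ∀ i, N ω (B i) = ENat.toENNReal (k i)} := by
  rw [Set.ofPred_forall]
  exact MeasurableSet.iInter fun i => h.measurable_apply (hB i) (measurableSet_singleton _)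

/-- Λ is not assumed measurable: measurability of these products is inherited, up to null sets, from
the conditional expectations they equal. -/
lemma IsCondPoisson.aemeasurable_prod (h : IsCondPoisson m P N Λ) (hm : m ≤ mΩ) {n : ℕ}
    {B : Fin n → Set E} (hB : ∀ i, MeasurableSet (B i))
    (hd : Pairwise fun i j => Disjoint (B i) (B j)) (k : Fin n → ℕ∞) :
    AEMeasurable (fun ω => ∏ i, ENNReal.ofReal (poissonProb (Λ ω (B i)) (k i))) P := by
  have h1 : AEMeasurable (fun ω => ∏ i, poissonProb (Λ ω (B i)) (k i)) P :=
    (stronglyMeasurable_condExp.mono hm).measurable.aemeasurable.congr (h.law n B k hB hd)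
  refine h1.ennreal_ofReal.congr (ae_of_all _ fun ω => ?_)
  exact ENNReal.ofReal_prod_of_nonneg fun i _ => poissonProb_nonneg _ _

lemma IsCondPoisson.aemeasurable_poissonProb (h : IsCondPoisson m P N Λ) (hm : m ≤ mΩ)
    {B : Set E} (hB : MeasurableSet B) (k : ℕ∞) :
    AEMeasurable (fun ω => ENNReal.ofReal (poissonProb (Λ ω B) k)) P := by
  simpa using h.aemeasurable_prod hm (B := fun _ : Fin 1 => B) (fun _ => hB)
    (fun i j hij => (hij (Subsingleton.elim i j)).elim) (fun _ => k)

/-- Λ(B) is recovered as the mean of its own Poisson law, a countable sum of almost everywhere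
measurable terms. -/
lemma IsCondPoisson.aemeasurable_mean (h : IsCondPoisson m P N Λ) (hm : m ≤ mΩ)
    {B : Set E} (hB : MeasurableSet B) : AEMeasurable (fun ω => Λ ω B) P := by
  have : AEMeasurable
      (fun ω => ∑' k : ℕ∞, (k : ℝ≥0∞) * ENNReal.ofReal (poissonProb (Λ ω B) k)) P :=
    AEMeasurable.tsum fun k => (h.aemeasurable_poissonProb hm hB k).const_mul _
  simpa only [tsum_mul_poissonProb] using this

/-- The integral of a function of a discrete random variable. -/
lemma lintegral_eq_tsum_of_partition {ι : Type*} [Countable ι] {S : ι → Set Ω}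
    (hS : ∀ i, MeasurableSet (S i)) (hd : Pairwise (Function.onFun Disjoint S))
    (hcov : ∀ᵐ ω ∂P, ω ∈ ⋃ i, S i) {F : Ω → ℝ≥0∞} {c : ι → ℝ≥0∞}
    (hF : ∀ i, ∀ ω ∈ S i, F ω = c i) : ∫⁻ ω, F ω ∂P = ∑' i, c i * P (S i) := by
  have h1 : (⋃ i, S i : Set Ω) =ᵐ[P] Set.univ := eventuallyEq_univ.2 hcov
  rw [← setLIntegral_univ, ← setLIntegral_congr h1, lintegral_iUnion hS hd]
  refine tsum_congr fun i => ?_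
  rw [setLIntegral_congr_fun (hS i) (hF i), setLIntegral_const]

variable [IsProbabilityMeasure P]

lemma IsCondPoisson.measure_eq (h : IsCondPoisson m P N Λ) (hm : m ≤ mΩ) {n : ℕ}
    {B : Fin n → Set E} (hB : ∀ i, MeasurableSet (B i))
    (hd : Pairwise fun i j => Disjoint (B i) (B j)) (k : Fin n → ℕ∞) :
    P {ω | ∀ i, N ω (B i) = ENat.toENNReal (k i)} =
      ∫⁻ ω, ∏ i, ENNReal.ofReal (poissonProb (Λ ω (B i)) (k i)) ∂P := by
  have hS := h.measurableSet_eq hB k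
  have hlaw := h.law n B k hB hd
  have hint : Integrable (fun ω => ∏ i, poissonProb (Λ ω (B i)) (k i)) P :=
    integrable_condExp.congr hlaw
  have h1 : P.real {ω | ∀ i, N ω (B i) = ENat.toENNReal (k i)} =
      ∫ ω, ∏ i, poissonProb (Λ ω (B i)) (k i) ∂P := by
    rw [← integral_congr_ae hlaw, integral_condExp hm, integral_indicator hS]
    simp
  rw [← ofReal_measureReal, h1, ofReal_integral_eq_lintegral_ofReal hint
    (ae_of_all _ fun ω => Finset.prod_nonneg fun i _ => poissonProb_nonneg _ _)]
  exact lintegral_congr fun ω => ENNReal.ofReal_prod_of_nonneg fun i _ => poissonProb_nonneg _ _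

lemma IsCondPoisson.measure_apply_eq (h : IsCondPoisson m P N Λ) (hm : m ≤ mΩ)
    {B : Set E} (hB : MeasurableSet B) (k : ℕ∞) :
    P {ω | N ω B = k} = ∫⁻ ω, ENNReal.ofReal (poissonProb (Λ ω B) k) ∂P := by
  simpa using h.measure_eq hm (B := fun _ : Fin 1 => B) (fun _ => hB)
    (fun i j hij => (hij (Subsingleton.elim i j)).elim) (fun _ => k)

/-- N is not assumed integer-valued; since the Poisson probabilities sum to 1, it almost surely
takes values in {0, 1, …, ∞} on each fixed set. -/
lemma IsCondPoisson.ae_mem_iUnion (h : IsCondPoisson m P N Λ) (hm : m ≤ mΩ)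
    {B : Set E} (hB : MeasurableSet B) : ∀ᵐ ω ∂P, ω ∈ ⋃ k : ℕ∞, {ω | N ω B = k} := by
  have hS : ∀ k : ℕ∞, MeasurableSet {ω | N ω B = k} := fun k =>
    h.measurable_apply hB (measurableSet_singleton _)
  refine (mem_ae_iff_prob_eq_one (MeasurableSet.iUnion hS)).2 ?_
  rw [measure_iUnion (pairwise_disjoint_apply_eq N B) hS]
  simp only [h.measure_apply_eq hm hB]
  rw [← lintegral_tsum fun k => h.aemeasurable_poissonProb hm hB k]
  simp [tsum_poissonProb]

/-- Since N(B) is almost surely discrete, both sides are the same countable sum, so ψ may be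
arbitrary. -/
lemma IsCondPoisson.lintegral_comp (h : IsCondPoisson m P N Λ) (hm : m ≤ mΩ)
    {B : Set E} (hB : MeasurableSet B) (ψ : ℝ≥0∞ → ℝ≥0∞) :
    ∫⁻ ω, ψ (N ω B) ∂P =
      ∫⁻ ω, ∑' k : ℕ∞, ψ k * ENNReal.ofReal (poissonProb (Λ ω B) k) ∂P := by
  rw [lintegral_tsum fun k => (h.aemeasurable_poissonProb hm hB k).const_mul _,
    lintegral_eq_tsum_of_partition (S := fun k : ℕ∞ => {ω | N ω B = k}) (c := fun k => ψ k)
    (fun k => h.measurable_apply hB (measurableSet_singleton _)) (pairwise_disjoint_apply_eq N B)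
    (h.ae_mem_iUnion hm hB) fun k ω hω => by rw [show N ω B = k from hω]]
  refine tsum_congr fun k => ?_
  rw [h.measure_apply_eq hm hB, lintegral_const_mul'' _ (h.aemeasurable_poissonProb hm hB k)]

lemma IsCondPoisson.lintegral_apply (h : IsCondPoisson m P N Λ) (hm : m ≤ mΩ)
    {B : Set E} (hB : MeasurableSet B) : ∫⁻ ω, N ω B ∂P = ∫⁻ ω, Λ ω B ∂P := by
  simpa only [id, tsum_mul_poissonProb] using h.lintegral_comp hm hB id

lemma IsCondPoisson.lintegral_apply_sq (h : IsCondPoisson m P N Λ) (hm : m ≤ mΩ)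
    {B : Set E} (hB : MeasurableSet B) :
    ∫⁻ ω, N ω B * N ω B ∂P = ∫⁻ ω, Λ ω B + Λ ω B * Λ ω B ∂P := by
  simpa only [tsum_sq_mul_poissonProb] using h.lintegral_comp hm hB fun x => x * x

/-- Conditional independence makes the joint law a mixture of products, so the double sum factors
into two Poisson means under the integral. -/
lemma IsCondPoisson.lintegral_apply_mul_of_disjoint (h : IsCondPoisson m P N Λ) (hm : m ≤ mΩ)
    {A B : Set E} (hA : MeasurableSet A) (hB : MeasurableSet B) (hAB : Disjoint A B) :
    ∫⁻ ω, N ω A * N ω B ∂P = ∫⁻ ω, Λ ω A * Λ ω B ∂P := by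
  have hmeas : ∀ i, MeasurableSet (![A, B] i) := by
    intro i; fin_cases i <;> assumption
  have hd : Pairwise fun i j => Disjoint (![A, B] i) (![A, B] j) := by
    intro i j hij
    fin_cases i <;> fin_cases j <;> first | exact (hij rfl).elim | exact hAB | exact hAB.symm
  have hlaw : ∀ p : ℕ∞ × ℕ∞, P ({ω | N ω A = p.1} ∩ {ω | N ω B = p.2}) =
      ∫⁻ ω, ENNReal.ofReal (poissonProb (Λ ω A) p.1) *
        ENNReal.ofReal (poissonProb (Λ ω B) p.2) ∂P := fun p => by
    have := h.measure_eq hm hmeas hd ![p.1, p.2]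
    simpa [Fin.forall_fin_two, Fin.prod_univ_two, Set.ofPred_and] using this
  have haem : ∀ p : ℕ∞ × ℕ∞, AEMeasurable (fun ω => ENNReal.ofReal (poissonProb (Λ ω A) p.1) *
      ENNReal.ofReal (poissonProb (Λ ω B) p.2)) P := fun p =>
    (h.aemeasurable_poissonProb hm hA _).mul (h.aemeasurable_poissonProb hm hB _)
  rw [lintegral_eq_tsum_of_partition (F := fun ω => N ω A * N ω B)
    (S := fun p : ℕ∞ × ℕ∞ => {ω | N ω A = p.1} ∩ {ω | N ω B = p.2})
    (c := fun p => (p.1 : ℝ≥0∞) * p.2)]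
  · simp only [hlaw]
    calc ∑' p : ℕ∞ × ℕ∞, (p.1 : ℝ≥0∞) * p.2 * ∫⁻ ω, ENNReal.ofReal (poissonProb (Λ ω A) p.1) *
          ENNReal.ofReal (poissonProb (Λ ω B) p.2) ∂P
        = ∫⁻ ω, ∑' p : ℕ∞ × ℕ∞, (p.1 : ℝ≥0∞) * p.2 * (ENNReal.ofReal (poissonProb (Λ ω A) p.1) *
          ENNReal.ofReal (poissonProb (Λ ω B) p.2)) ∂P := by
          rw [lintegral_tsum fun p => (haem p).const_mul _]
          exact tsum_congr fun p => (lintegral_const_mul'' _ (haem p)).symm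
      _ = ∫⁻ ω, Λ ω A * Λ ω B ∂P := lintegral_congr fun ω => by
          rw [ENNReal.tsum_prod (f := fun j k : ℕ∞ => (j : ℝ≥0∞) * k *
            (ENNReal.ofReal (poissonProb (Λ ω A) j) * ENNReal.ofReal (poissonProb (Λ ω B) k)))]
          simp only [mul_mul_mul_comm _ _ (ENNReal.ofReal _), ENNReal.tsum_mul_left,
            ENNReal.tsum_mul_right, tsum_mul_poissonProb]
  · exact fun p => (h.measurable_apply hA (measurableSet_singleton _)).inter
      (h.measurable_apply hB (measurableSet_singleton _))
  · rintro ⟨i, j⟩ ⟨i', j'⟩ hne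
    refine Set.disjoint_left.2 fun ω hω hω' => hne (Prod.ext ?_ ?_)
    · exact ENat.toENNReal_inj.1 (Eq.trans (Eq.symm hω.1) hω'.1)
    · exact ENat.toENNReal_inj.1 (Eq.trans (Eq.symm hω.2) hω'.2)
  · filter_upwards [h.ae_mem_iUnion hm hA, h.ae_mem_iUnion hm hB] with ω h1 h2
    obtain ⟨j, hj⟩ := Set.mem_iUnion.1 h1
    obtain ⟨k, hk⟩ := Set.mem_iUnion.1 h2
    exact Set.mem_iUnion.2 ⟨(j, k), hj, hk⟩
  · rintro p ω ⟨h1, h2⟩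
    rw [show N ω A = p.1 from h1, show N ω B = p.2 from h2]

/-- Second-order moments of a conditionally Poisson random measure. -/
lemma IsCondPoisson.lintegral_apply_mul (h : IsCondPoisson m P N Λ) (hm : m ≤ mΩ)
    {A B : Set E} (hA : MeasurableSet A) (hB : MeasurableSet B) :
    ∫⁻ ω, N ω A * N ω B ∂P = ∫⁻ ω, Λ ω (A ∩ B) ∂P + ∫⁻ ω, Λ ω A * Λ ω B ∂P := by
  have hI := hA.inter hB
  have hA' := hA.diff hB
  have hB' := hB.diff hA
  -- Cutting A and B along A ∩ B leaves three products over disjoint sets and the square of the mass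
  -- of A ∩ B; only the square produces the extra term Λ(A ∩ B).
  have split : ∀ μ : Measure E, μ A * μ B = μ (A \ B) * μ (B \ A) + μ (A \ B) * μ (A ∩ B) +
      μ (A ∩ B) * μ (B \ A) + μ (A ∩ B) * μ (A ∩ B) := fun μ => by
    rw [← measure_inter_add_sdiff A hB (μ := μ), ← measure_inter_add_sdiff B hA (μ := μ),
      Set.inter_comm B A]
    ring
  have mN : ∀ {C}, MeasurableSet C → AEMeasurable (fun ω => N ω C) P := fun hC =>
    (h.measurable_apply hC).aemeasurable
  have mL : ∀ {C}, MeasurableSet C → AEMeasurable (fun ω => Λ ω C) P := fun hC =>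
    h.aemeasurable_mean hm hC
  have expand : ∀ M : Ω → Measure E, (∀ {C}, MeasurableSet C → AEMeasurable (fun ω => M ω C) P) →
      ∫⁻ ω, M ω A * M ω B ∂P = ∫⁻ ω, M ω (A \ B) * M ω (B \ A) ∂P +
        ∫⁻ ω, M ω (A \ B) * M ω (A ∩ B) ∂P + ∫⁻ ω, M ω (A ∩ B) * M ω (B \ A) ∂P +
        ∫⁻ ω, M ω (A ∩ B) * M ω (A ∩ B) ∂P := fun M mM => by
    have mul : ∀ {C D}, MeasurableSet C → MeasurableSet D →
        AEMeasurable (fun ω => M ω C * M ω D) P := fun hC hD => (mM hC).mul (mM hD)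
    simp only [split]
    rw [lintegral_add_right' _ (mul hI hI), lintegral_add_right' _ (mul hI hB'),
      lintegral_add_right' _ (mul hA' hI)]
  rw [expand N mN, expand Λ mL, h.lintegral_apply_mul_of_disjoint hm hA' hB' disjoint_sdiff_sdiff,
    h.lintegral_apply_mul_of_disjoint hm hA' hI (Set.disjoint_left.2 fun x h1 h2 => h1.2 h2.2),
    h.lintegral_apply_mul_of_disjoint hm hI hB' (Set.disjoint_left.2 fun x h1 h2 => h2.2 h1.1),
    h.lintegral_apply_sq hm hI, lintegral_add_left' (mL hI)]
  ring

end Poisson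

/-! ### Uniqueness and finiteness of densities, and Tonelli for the shot noise kernel. -/

section ProductDensities

/-- A density is determined by its integrals over bounded sets when these are finite. -/
lemma ae_eq_of_setLIntegral_bounded_eq {E : Type*} [PseudoMetricSpace E] [MeasurableSpace E]
    [OpensMeasurableSpace E] {ℓ : Measure E} {D D' : E → ℝ≥0∞} (hD : Measurable D)
    (hD' : Measurable D')
    (h : ∀ B : Set E, MeasurableSet B → Bornology.IsBounded B →
      ∫⁻ y in B, D y ∂ℓ = ∫⁻ y in B, D' y ∂ℓ)
    (hfin : ∀ B : Set E, MeasurableSet B → Bornology.IsBounded B → ∫⁻ y in B, D y ∂ℓ ≠ ∞) :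
    ∀ᵐ y ∂ℓ, D y = D' y := by
  obtain ⟨s, -, hm, hb, hu⟩ := exists_bounded_exhaustion E
  rw [← Measure.restrict_univ (μ := ℓ), ← hu, ae_restrict_iUnion_iff]
  intro n
  refine (withDensity_eq_iff hD.aemeasurable hD'.aemeasurable (hfin _ (hm n) (hb n))).1 ?_
  refine Measure.ext fun B hB => ?_
  rw [withDensity_apply _ hB, withDensity_apply _ hB, Measure.restrict_restrict hB]
  exact h _ (hB.inter (hm n)) ((hb n).subset Set.inter_subset_right)

/-- A density on a product is determined by its integrals over bounded rectangles when these are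
finite. -/
lemma ae_eq_of_setLIntegral_bounded_prod_eq {E : Type*} [PseudoMetricSpace E]
    [MeasurableSpace E] [OpensMeasurableSpace E] {μ : Measure (E × E)} {D D' : E × E → ℝ≥0∞}
    (hD : Measurable D) (hD' : Measurable D')
    (h : ∀ B₁ B₂ : Set E, MeasurableSet B₁ → Bornology.IsBounded B₁ → MeasurableSet B₂ →
      Bornology.IsBounded B₂ → ∫⁻ p in B₁ ×ˢ B₂, D p ∂μ = ∫⁻ p in B₁ ×ˢ B₂, D' p ∂μ)
    (hfin : ∀ B : Set E, MeasurableSet B → Bornology.IsBounded B →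
      ∫⁻ p in B ×ˢ B, D p ∂μ ≠ ∞) :
    ∀ᵐ p ∂μ, D p = D' p := by
  obtain ⟨s, hmono, hm, hb, hu⟩ := exists_bounded_exhaustion E
  have hu2 : ⋃ n, s n ×ˢ s n = Set.univ := by
    rw [Set.iUnion_prod_of_monotone hmono hmono, hu, Set.univ_prod_univ]
  rw [← Measure.restrict_univ (μ := μ), ← hu2, ae_restrict_iUnion_iff]
  intro n
  have hf := hfin _ (hm n) (hb n)
  have hfinite : IsFiniteMeasure ((μ.restrict (s n ×ˢ s n)).withDensity D) :=
    isFiniteMeasure_withDensity hf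
  refine (withDensity_eq_iff hD.aemeasurable hD'.aemeasurable hf).1 ?_
  have hrect : ∀ A B : Set E, MeasurableSet A → MeasurableSet B →
      (μ.restrict (s n ×ˢ s n)).withDensity D (A ×ˢ B) =
        (μ.restrict (s n ×ˢ s n)).withDensity D' (A ×ˢ B) := fun A B hA hB => by
    rw [withDensity_apply _ (hA.prod hB), withDensity_apply _ (hA.prod hB),
      Measure.restrict_restrict (hA.prod hB), Set.prod_inter_prod]
    exact h _ _ (hA.inter (hm n)) ((hb n).subset Set.inter_subset_right) (hB.inter (hm n))
      ((hb n).subset Set.inter_subset_right)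
  -- Measurable rectangles form a π-system generating the product σ-algebra, and `D` defines a
  -- finite measure on each `s n ×ˢ s n`.
  refine ext_of_generate_finite _ generateFrom_prod.symm isPiSystem_prod ?_ ?_
  · rintro _ ⟨A, hA, B, hB, rfl⟩
    exact hrect A B hA hB
  · rw [← Set.univ_prod_univ]
    exact hrect _ _ .univ .univ

lemma ae_lt_top_of_setLIntegral_bounded {E : Type*} [PseudoMetricSpace E] [MeasurableSpace E]
    [OpensMeasurableSpace E] {ℓ : Measure E} {D : E → ℝ≥0∞} (hD : Measurable D)
    (hfin : ∀ B : Set E, MeasurableSet B → Bornology.IsBounded B → ∫⁻ y in B, D y ∂ℓ ≠ ∞) :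
    ∀ᵐ y ∂ℓ, D y < ∞ := by
  obtain ⟨s, -, hm, hb, hu⟩ := exists_bounded_exhaustion E
  rw [← Measure.restrict_univ (μ := ℓ), ← hu, ae_restrict_iUnion_iff]
  exact fun n => ae_lt_top hD (hfin _ (hm n) (hb n))

lemma ae_lt_top_of_setLIntegral_bounded_prod {E : Type*} [PseudoMetricSpace E]
    [MeasurableSpace E] [OpensMeasurableSpace E] {μ : Measure (E × E)} {D : E × E → ℝ≥0∞}
    (hD : Measurable D) (hfin : ∀ B : Set E, MeasurableSet B → Bornology.IsBounded B →
      ∫⁻ p in B ×ˢ B, D p ∂μ ≠ ∞) :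
    ∀ᵐ p ∂μ, D p < ∞ := by
  obtain ⟨s, hmono, hm, hb, hu⟩ := exists_bounded_exhaustion E
  have hu2 : ⋃ n, s n ×ˢ s n = Set.univ := by
    rw [Set.iUnion_prod_of_monotone hmono hmono, hu, Set.univ_prod_univ]
  rw [← Measure.restrict_univ (μ := μ), ← hu2, ae_restrict_iUnion_iff]
  exact fun n => ae_lt_top hD (hfin _ (hm n) (hb n))

lemma AreProductDensities.ae_eq {Ω 𝕐 : Type*} [MeasurableSpace Ω] [PseudoMetricSpace 𝕐]
    [MeasurableSpace 𝕐] [OpensMeasurableSpace 𝕐] {P : Measure Ω} {N : Ω → Measure 𝕐}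
    {ℓ : Measure 𝕐} {D₁ D₁' : 𝕐 → ℝ≥0∞} {D₂ D₂' : 𝕐 → 𝕐 → ℝ≥0∞}
    (h : AreProductDensities P N ℓ D₁ D₂) (h' : AreProductDensities P N ℓ D₁' D₂')
    (hfin₁ : ∀ B : Set 𝕐, MeasurableSet B → Bornology.IsBounded B → ∫⁻ y in B, D₁ y ∂ℓ ≠ ∞)
    (hfin₂ : ∀ B : Set 𝕐, MeasurableSet B → Bornology.IsBounded B →
      ∫⁻ p in B ×ˢ B, D₂ p.1 p.2 ∂(ℓ.prod ℓ) ≠ ∞) :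
    (∀ᵐ y ∂ℓ, D₁ y = D₁' y) ∧ ∀ᵐ p ∂(ℓ.prod ℓ), D₂ p.1 p.2 = D₂' p.1 p.2 := by
  have h1 : ∀ B : Set 𝕐, MeasurableSet B → Bornology.IsBounded B →
      ∫⁻ y in B, D₁ y ∂ℓ = ∫⁻ y in B, D₁' y ∂ℓ := fun B hB hb =>
    (h.first B hB hb).symm.trans (h'.first B hB hb)
  refine ⟨ae_eq_of_setLIntegral_bounded_eq h.measurable_one h'.measurable_one h1 hfin₁,
    ae_eq_of_setLIntegral_bounded_prod_eq h.measurable_two h'.measurable_two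
      (fun B₁ B₂ hB₁ hb₁ hB₂ hb₂ => ?_) hfin₂⟩
  have hI := hB₁.inter hB₂
  have hb : Bornology.IsBounded (B₁ ∩ B₂) := hb₁.subset Set.inter_subset_left
  have := (h.second B₁ B₂ hB₁ hb₁ hB₂ hb₂).symm.trans (h'.second B₁ B₂ hB₁ hb₁ hB₂ hb₂)
  -- The diagonal terms of the two second-moment identities agree and are finite, so they cancel.
  rw [← h1 _ hI hb] at this
  exact (ENNReal.add_right_inj (hfin₁ _ hI hb)).1 this

variable {𝕐 Θ : Type*} [MeasurableSpace 𝕐] [MeasurableSpace Θ] {K : 𝕐 → Θ → ℝ≥0}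
  {ℓ : Measure 𝕐} {w : Measure Θ}

lemma measurable_shotNoise (hK : Measurable (Function.uncurry K)) [SFinite w] :
    Measurable (shotNoise K w) :=
  Measurable.lintegral_prod_right' (f := fun p : 𝕐 × Θ => (K p.1 p.2 : ℝ≥0∞))
    hK.coe_nnreal_ennreal

lemma measurable_setLIntegral_kernel (hK : Measurable (Function.uncurry K)) [SFinite ℓ]
    (B : Set 𝕐) : Measurable fun θ => ∫⁻ y in B, (K y θ : ℝ≥0∞) ∂ℓ :=
  Measurable.lintegral_prod_left' (f := fun p : 𝕐 × Θ => (K p.1 p.2 : ℝ≥0∞))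
    hK.coe_nnreal_ennreal

lemma measurable_kernel_mul (hK : Measurable (Function.uncurry K)) :
    Measurable fun q : (𝕐 × 𝕐) × Θ => (K q.1.1 q.2 : ℝ≥0∞) * (K q.1.2 q.2 : ℝ≥0∞) :=
  ((hK.comp ((measurable_fst.comp measurable_fst).prodMk measurable_snd)).coe_nnreal_ennreal).mul
    ((hK.comp ((measurable_snd.comp measurable_fst).prodMk measurable_snd)).coe_nnreal_ennreal)

lemma setLIntegral_shotNoise (hK : Measurable (Function.uncurry K)) [SFinite ℓ] [SFinite w]
    (B : Set 𝕐) :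
    ∫⁻ y in B, shotNoise K w y ∂ℓ = ∫⁻ θ, ∫⁻ y in B, (K y θ : ℝ≥0∞) ∂ℓ ∂w :=
  lintegral_lintegral_swap hK.coe_nnreal_ennreal.aemeasurable

/-- For fixed θ the kernel product separates in y₁ and y₂, so Tonelli brings the double integral to
the form ∫hk dw of the gamma second moment. -/
lemma setLIntegral_prod_kernel_mul (hK : Measurable (Function.uncurry K)) [SFinite ℓ] [SFinite w]
    (B₁ B₂ : Set 𝕐) :
    ∫⁻ p in B₁ ×ˢ B₂, ∫⁻ θ, (K p.1 θ : ℝ≥0∞) * (K p.2 θ : ℝ≥0∞) ∂w ∂(ℓ.prod ℓ) =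
      ∫⁻ θ, (∫⁻ y in B₁, (K y θ : ℝ≥0∞) ∂ℓ) * ∫⁻ y in B₂, (K y θ : ℝ≥0∞) ∂ℓ ∂w := by
  rw [lintegral_lintegral_swap (measurable_kernel_mul hK).aemeasurable]
  refine lintegral_congr fun θ => ?_
  have hKθ : Measurable fun y => (K y θ : ℝ≥0∞) :=
    (hK.comp (measurable_id.prodMk measurable_const)).coe_nnreal_ennreal
  rw [← Measure.prod_restrict]
  exact lintegral_prod_mul hKθ.aemeasurable hKθ.aemeasurable

lemma setLIntegral_prod_shotNoise_mul (hK : Measurable (Function.uncurry K)) [SFinite ℓ]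
    [SFinite w] (B₁ B₂ : Set 𝕐) :
    ∫⁻ p in B₁ ×ˢ B₂, shotNoise K w p.1 * shotNoise K w p.2 ∂(ℓ.prod ℓ) =
      (∫⁻ y in B₁, shotNoise K w y ∂ℓ) * ∫⁻ y in B₂, shotNoise K w y ∂ℓ := by
  rw [← Measure.prod_restrict]
  exact lintegral_prod_mul (measurable_shotNoise hK).aemeasurable
    (measurable_shotNoise hK).aemeasurable

end ProductDensities

/-- The mean measure of the shot noise process, expressed through the driving measure. -/
lemma withDensity_shotNoise_apply {𝕐 Θ : Type*} [MeasurableSpace 𝕐] [MeasurableSpace Θ]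
    {K : 𝕐 → Θ → ℝ≥0} {ℓ : Measure 𝕐} {w : Measure Θ} (hK : Measurable (Function.uncurry K))
    [SFinite ℓ] [SFinite w] (κ : ℝ≥0) {B : Set 𝕐} (hB : MeasurableSet B) :
    ℓ.withDensity (fun y => (κ : ℝ≥0∞) * shotNoise K w y) B =
      κ * ∫⁻ θ, ∫⁻ y in B, (K y θ : ℝ≥0∞) ∂ℓ ∂w := by
  rw [withDensity_apply _ hB, lintegral_const_mul _ (measurable_shotNoise hK),
    setLIntegral_shotNoise hK]

/-! ### Gamma shot noise: pointwise densities and their integrals. -/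

section GammaShotNoise

variable {Ω 𝕐 Θ : Type*} [MeasurableSpace Ω] [MeasurableSpace 𝕐] [PseudoMetricSpace Θ]
  [MeasurableSpace Θ] [OpensMeasurableSpace Θ] {P : Measure Ω} [IsProbabilityMeasure P]
  {X : Ω → Measure Θ} {H : Measure Θ} {b : ℝ} {K : 𝕐 → Θ → ℝ≥0}

lemma IsGammaRandomMeasure.intensity_eq (hX : IsGammaRandomMeasure P X H b) (hb : 0 < b)
    (hH : BoundedlyFinite H) (hK : Measurable (Function.uncurry K)) (κ : ℝ≥0) (y : 𝕐) :
    intensity P X κ K y = (κ * ENNReal.ofReal b⁻¹) * shotNoise K H y := by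
  have hKy : Measurable fun θ => (K y θ : ℝ≥0∞) :=
    (hK.comp (measurable_const.prodMk measurable_id)).coe_nnreal_ennreal
  rw [mul_assoc, shotNoise, ← hX.lintegral_lintegral hb hH hKy]
  rfl

/-- This is the gamma second moment at h = K(y₁,·), k = K(y₂,·), valid even where the values are
infinite. -/
lemma IsGammaRandomMeasure.productDensity_eq (hX : IsGammaRandomMeasure P X H b) (hb : 0 < b)
    (hH : BoundedlyFinite H) (hK : Measurable (Function.uncurry K)) (κ : ℝ≥0) (y₁ y₂ : 𝕐) :
    productDensity P X κ K y₁ y₂ = (κ * ENNReal.ofReal b⁻¹) ^ 2 *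
      (shotNoise K H y₁ * shotNoise K H y₂ +
        ∫⁻ θ, (K y₁ θ : ℝ≥0∞) * (K y₂ θ : ℝ≥0∞) ∂H) := by
  have hKy : ∀ y, Measurable fun θ => (K y θ : ℝ≥0∞) := fun y =>
    (hK.comp (measurable_const.prodMk measurable_id)).coe_nnreal_ennreal
  have := hX.lintegral_mul_lintegral hb hH (hKy y₁) (hKy y₂)
  rw [mul_pow, mul_assoc, shotNoise, shotNoise, ← this]
  rfl

lemma measurable_shotNoise_mul_add (hK : Measurable (Function.uncurry K)) (hH : BoundedlyFinite H) :
    Measurable fun p : 𝕐 × 𝕐 => shotNoise K H p.1 * shotNoise K H p.2 +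
      ∫⁻ θ, (K p.1 θ : ℝ≥0∞) * (K p.2 θ : ℝ≥0∞) ∂H := by
  have hHσ : SigmaFinite H := hH.sigmaFinite
  have hS : Measurable (shotNoise K H) := measurable_shotNoise hK
  exact ((hS.comp measurable_fst).mul (hS.comp measurable_snd)).add
    (Measurable.lintegral_prod_right' (measurable_kernel_mul hK))

lemma IsGammaRandomMeasure.setLIntegral_productDensity (hX : IsGammaRandomMeasure P X H b)
    (hb : 0 < b) (hH : BoundedlyFinite H) (hK : Measurable (Function.uncurry K))
    {ℓ : Measure 𝕐} [SFinite ℓ] (κ : ℝ≥0) (B₁ B₂ : Set 𝕐) :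
    ∫⁻ p in B₁ ×ˢ B₂, productDensity P X κ K p.1 p.2 ∂(ℓ.prod ℓ) =
      (κ * ENNReal.ofReal b⁻¹) ^ 2 *
        ((∫⁻ y in B₁, shotNoise K H y ∂ℓ) * (∫⁻ y in B₂, shotNoise K H y ∂ℓ) +
          ∫⁻ p in B₁ ×ˢ B₂, ∫⁻ θ, (K p.1 θ : ℝ≥0∞) * (K p.2 θ : ℝ≥0∞) ∂H ∂(ℓ.prod ℓ)) := by
  have hHσ : SigmaFinite H := hH.sigmaFinite
  have hS : Measurable (shotNoise K H) := measurable_shotNoise hK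
  have hSS : Measurable fun p : 𝕐 × 𝕐 => shotNoise K H p.1 * shotNoise K H p.2 :=
    (hS.comp measurable_fst).mul (hS.comp measurable_snd)
  simp only [hX.productDensity_eq hb hH hK]
  rw [lintegral_const_mul _ (measurable_shotNoise_mul_add hK hH), lintegral_add_left hSS,
    setLIntegral_prod_shotNoise_mul hK]

variable [PseudoMetricSpace 𝕐] {ℓ : Measure 𝕐} {N : Ω → Measure 𝕐} {κ : ℝ≥0}

lemma IsGammaRandomMeasure.setLIntegral_intensity_ne_top (hX : IsGammaRandomMeasure P X H b)
    (hb : 0 < b) (hH : BoundedlyFinite H) (hK : Measurable (Function.uncurry K))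
    {V : Measure Θ} (h1 : CondH1 K ℓ H V) (B : Set 𝕐) (hB : MeasurableSet B)
    (hbd : Bornology.IsBounded B) : ∫⁻ y in B, intensity P X κ K y ∂ℓ ≠ ∞ := by
  have hHσ : SigmaFinite H := hH.sigmaFinite
  simp only [hX.intensity_eq hb hH hK]
  rw [lintegral_const_mul _ (measurable_shotNoise hK)]
  refine ENNReal.mul_ne_top (ENNReal.mul_ne_top ENNReal.coe_ne_top ENNReal.ofReal_ne_top)
    (ne_top_of_le_ne_top (h1 B hB hbd).2.ne ?_)
  -- H ≤ H + V, so the bound in (H1) also controls integrals against H alone.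
  exact lintegral_mono fun y => lintegral_mono' (Measure.le_add_right le_rfl) le_rfl

variable [SFinite ℓ]

/-- The pointwise moment densities of a Poisson process driven by gamma shot noise. -/
lemma IsGammaRandomMeasure.areProductDensities (hX : IsGammaRandomMeasure P X H b) (hb : 0 < b)
    (hH : BoundedlyFinite H) (hK : Measurable (Function.uncurry K))
    (hN : IsCondPoisson (MeasurableSpace.comap X inferInstance) P N
      fun ω => ℓ.withDensity fun y => (κ : ℝ≥0∞) * shotNoise K (X ω) y) :
    AreProductDensities P N ℓ (intensity P X κ K) (productDensity P X κ K) := by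
  have hHσ : SigmaFinite H := hH.sigmaFinite
  have hXσ : ∀ ω, SigmaFinite (X ω) := fun ω =>
    (hX.isRandomMeasure.boundedlyFinite ω).sigmaFinite
  have hm := hX.isRandomMeasure.measurable.comap_le
  have hI : intensity P X κ K = fun y => (κ * ENNReal.ofReal b⁻¹) * shotNoise K H y :=
    funext fun y => hX.intensity_eq hb hH hK κ y
  have hJ : productDensity P X κ K = fun y₁ y₂ => (κ * ENNReal.ofReal b⁻¹) ^ 2 *
      (shotNoise K H y₁ * shotNoise K H y₂ +
        ∫⁻ θ, (K y₁ θ : ℝ≥0∞) * (K y₂ θ : ℝ≥0∞) ∂H) :=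
    funext₂ fun y₁ y₂ => hX.productDensity_eq hb hH hK κ y₁ y₂
  have hS : Measurable (shotNoise K H) := measurable_shotNoise hK
  have hmean : ∀ B : Set 𝕐, MeasurableSet B →
      ∫⁻ ω, ℓ.withDensity (fun y => (κ : ℝ≥0∞) * shotNoise K (X ω) y) B ∂P =
        ∫⁻ y in B, intensity P X κ K y ∂ℓ := fun B hB => by
    have hh := measurable_setLIntegral_kernel (ℓ := ℓ) hK B
    simp only [withDensity_shotNoise_apply hK κ hB, hI]
    rw [lintegral_const_mul _ hS, setLIntegral_shotNoise hK, mul_assoc,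
      ← hX.lintegral_lintegral hb hH hh]
    exact lintegral_const_mul _ ((Measure.measurable_lintegral hh).comp
      hX.isRandomMeasure.measurable)
  refine ⟨hI ▸ hS.const_mul _, ?_, fun B hB _ => (hN.lintegral_apply hm hB).trans (hmean B hB),
    fun B₁ B₂ hB₁ _ hB₂ _ => ?_⟩
  · rw [hJ]
    exact (measurable_shotNoise_mul_add hK hH).const_mul _
  · rw [hN.lintegral_apply_mul hm hB₁ hB₂, hmean _ (hB₁.inter hB₂)]
    congr 1
    have h₁ := measurable_setLIntegral_kernel (ℓ := ℓ) hK B₁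
    have h₂ := measurable_setLIntegral_kernel (ℓ := ℓ) hK B₂
    simp only [withDensity_shotNoise_apply hK κ hB₁, withDensity_shotNoise_apply hK κ hB₂]
    -- Both sides become (κ/b)² times the gamma second-moment expression for h_i(θ) = ∫_{B_i} K(y,
    -- θ) ℓ(dy).
    rw [hX.setLIntegral_productDensity hb hH hK, setLIntegral_prod_kernel_mul hK,
      setLIntegral_shotNoise hK, setLIntegral_shotNoise hK, mul_pow, mul_assoc,
      ← hX.lintegral_mul_lintegral hb hH h₁ h₂, ← lintegral_const_mul]
    · exact lintegral_congr fun ω => by ring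
    · exact ((Measure.measurable_lintegral h₁).comp hX.isRandomMeasure.measurable).mul
        ((Measure.measurable_lintegral h₂).comp hX.isRandomMeasure.measurable)

lemma IsGammaRandomMeasure.setLIntegral_productDensity_ne_top
    (hX : IsGammaRandomMeasure P X H b) (hb : 0 < b) (hH : BoundedlyFinite H)
    (hK : Measurable (Function.uncurry K)) {V : Measure Θ} (h1 : CondH1 K ℓ H V)
    (h2 : CondH2 K ℓ H V) (B : Set 𝕐) (hB : MeasurableSet B) (hbd : Bornology.IsBounded B) :
    ∫⁻ p in B ×ˢ B, productDensity P X κ K p.1 p.2 ∂(ℓ.prod ℓ) ≠ ∞ := by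
  rw [hX.setLIntegral_productDensity hb hH hK]
  have hone : ∫⁻ y in B, shotNoise K H y ∂ℓ ≠ ∞ := ne_top_of_le_ne_top (h1 B hB hbd).2.ne
    (lintegral_mono fun y => lintegral_mono' (Measure.le_add_right le_rfl) le_rfl)
  have htwo : ∫⁻ p in B ×ˢ B, ∫⁻ θ, (K p.1 θ : ℝ≥0∞) * (K p.2 θ : ℝ≥0∞) ∂H ∂(ℓ.prod ℓ) ≠ ∞ :=
    ne_top_of_le_ne_top (h2 B B hB hbd hB hbd).ne
      (lintegral_mono fun p => lintegral_mono' (Measure.le_add_right le_rfl) le_rfl)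
  exact ENNReal.mul_ne_top (ENNReal.pow_ne_top
    (ENNReal.mul_ne_top ENNReal.coe_ne_top ENNReal.ofReal_ne_top))
    (ENNReal.add_ne_top.2 ⟨ENNReal.mul_ne_top hone hone, htwo⟩)

end GammaShotNoise

/-! ### Assembly of the result. -/

theorem proposition9 {Ω 𝕐 Θ : Type*} [MeasurableSpace Ω]
    [MetricSpace 𝕐] [PolishSpace 𝕐] [MeasurableSpace 𝕐] [BorelSpace 𝕐]
    [MetricSpace Θ] [PolishSpace Θ] [MeasurableSpace Θ] [BorelSpace Θ]
    (P : Measure Ω) [IsProbabilityMeasure P] (ℓ : Measure 𝕐) [SigmaFinite ℓ]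
    (N : ℕ → Ω → Measure 𝕐) (W : ℕ → Ω → Measure Θ) (H : Measure Θ)
    (βs cs : ℕ → ℝ) (κ : ℕ → ℝ≥0) (K : 𝕐 → Θ → ℝ≥0) (β c ρ : ℝ)
    (hN : IsSNMARG1 P N W H βs cs κ K ℓ)
    (h1 : CondH1 K ℓ H (P.bind (W 1)))
    (h2 : CondH2 K ℓ H (P.bind (W 1)))
    (h3 : CondH3 P K ℓ (W 1))
    (h4 : CondH4 P (W 1) H βs cs β c ρ)
    (t : ℕ) (ht : 1 ≤ t) :
    -- the pointwise versions are an intensity and a second-order product density of `N_t`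
    AreProductDensities P (N t) ℓ (intensity P (W t) (κ t) K) (productDensity P (W t) (κ t) K) ∧
    -- they are finite almost everywhere
    (∀ᵐ y ∂ℓ, intensity P (W t) (κ t) K y < ∞) ∧
    (∀ᵐ p ∂(ℓ.prod ℓ), productDensity P (W t) (κ t) K p.1 p.2 < ∞) ∧
    -- the two formulas at every point, in `[0, ∞]`
    (∀ y, intensity P (W t) (κ t) K y =
      ENNReal.ofReal (c * κ t / (1 - ρ)) * ∫⁻ θ, (K y θ : ℝ≥0∞) ∂H) ∧
    (∀ y₁ y₂, productDensity P (W t) (κ t) K y₁ y₂ =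
      intensity P (W t) (κ t) K y₁ * intensity P (W t) (κ t) K y₂ +
        ENNReal.ofReal (c ^ 2 * (κ t : ℝ) ^ 2 / (1 - ρ) ^ 2) *
          ∫⁻ θ, (K y₁ θ : ℝ≥0∞) * (K y₂ θ : ℝ≥0∞) ∂H) ∧
    (∀ y₁ y₂, intensity P (W t) (κ t) K y₁ * intensity P (W t) (κ t) K y₂ ≠ ∞ →
      productDensity P (W t) (κ t) K y₁ y₂ -
          intensity P (W t) (κ t) K y₁ * intensity P (W t) (κ t) K y₂ =
        ENNReal.ofReal (c ^ 2 * (κ t : ℝ) ^ 2 / (1 - ρ) ^ 2) *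
          ∫⁻ θ, (K y₁ θ : ℝ≥0∞) * (K y₂ θ : ℝ≥0∞) ∂H) ∧
    -- the same formulas, almost everywhere, for all other versions of the two densities
    (∀ (D₁ : 𝕐 → ℝ≥0∞) (D₂ : 𝕐 → 𝕐 → ℝ≥0∞), AreProductDensities P (N t) ℓ D₁ D₂ →
      (∀ᵐ y ∂ℓ, D₁ y < ∞ ∧
        D₁ y = ENNReal.ofReal (c * κ t / (1 - ρ)) * ∫⁻ θ, (K y θ : ℝ≥0∞) ∂H) ∧
      (∀ᵐ p ∂(ℓ.prod ℓ), D₂ p.1 p.2 < ∞ ∧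
        D₂ p.1 p.2 - D₁ p.1 * D₁ p.2 =
          ENNReal.ofReal (c ^ 2 * (κ t : ℝ) ^ 2 / (1 - ρ) ^ 2) *
            ∫⁻ θ, (K p.1 θ : ℝ≥0∞) * (K p.2 θ : ℝ≥0∞) ∂H)) := by
  have hc : 0 < c := h4.c_const 2 le_rfl ▸ hN.marg.c_pos 2 le_rfl
  have hρ : 0 < 1 - ρ := sub_pos.2 h4.rho_lt_one
  have hb : 0 < (1 - ρ) / c := div_pos hρ hc
  have hH := hN.marg.base_boundedlyFinite
  have hK := hN.measurable_kernel
  have hX := hN.marg.isGammaRandomMeasure h4 ht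
  have hA : (κ t : ℝ≥0∞) * ENNReal.ofReal ((1 - ρ) / c)⁻¹ =
      ENNReal.ofReal (c * κ t / (1 - ρ)) := by
    rw [← ENNReal.ofReal_coe_nnreal, ← ENNReal.ofReal_mul (NNReal.coe_nonneg _), inv_div]
    congr 1
    ring
  have hA2 : ENNReal.ofReal (c * κ t / (1 - ρ)) ^ 2 =
      ENNReal.ofReal (c ^ 2 * (κ t : ℝ) ^ 2 / (1 - ρ) ^ 2) := by
    rw [← ENNReal.ofReal_pow (by positivity), div_pow, mul_pow]
  have hone := hX.intensity_eq hb hH hK (κ t)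
  have htwo : ∀ y₁ y₂, productDensity P (W t) (κ t) K y₁ y₂ =
      intensity P (W t) (κ t) K y₁ * intensity P (W t) (κ t) K y₂ +
        ENNReal.ofReal (c ^ 2 * (κ t : ℝ) ^ 2 / (1 - ρ) ^ 2) *
          ∫⁻ θ, (K y₁ θ : ℝ≥0∞) * (K y₂ θ : ℝ≥0∞) ∂H := fun y₁ y₂ => by
    rw [hX.productDensity_eq hb hH hK, hone, hone, hA, ← hA2]
    ring
  rw [hA] at hone
  have hdens := hX.areProductDensities hb hH hK (hN.condPoisson t ht)
  have hfin₁ := hX.setLIntegral_intensity_ne_top (κ := κ t) hb hH hK h1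
  have hfin₂ := hX.setLIntegral_productDensity_ne_top (κ := κ t) hb hH hK h1 h2
  have hae₁ := ae_lt_top_of_setLIntegral_bounded hdens.measurable_one hfin₁
  have hae₂ := ae_lt_top_of_setLIntegral_bounded_prod hdens.measurable_two hfin₂
  have hsub : ∀ y₁ y₂, intensity P (W t) (κ t) K y₁ * intensity P (W t) (κ t) K y₂ ≠ ∞ →
      productDensity P (W t) (κ t) K y₁ y₂ -
          intensity P (W t) (κ t) K y₁ * intensity P (W t) (κ t) K y₂ =
        ENNReal.ofReal (c ^ 2 * (κ t : ℝ) ^ 2 / (1 - ρ) ^ 2) *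
          ∫⁻ θ, (K y₁ θ : ℝ≥0∞) * (K y₂ θ : ℝ≥0∞) ∂H := fun y₁ y₂ h => by
    -- Subtraction in [0,∞] is truncated; cancelling the product is legitimate because it is finite.
    rw [htwo, ENNReal.add_sub_cancel_left h]
  refine ⟨hdens, hae₁, hae₂, hone, htwo, hsub, fun D₁ D₂ hD => ?_⟩
  obtain ⟨he₁, he₂⟩ := hdens.ae_eq hD hfin₁ hfin₂
  refine ⟨?_, ?_⟩
  · filter_upwards [he₁, hae₁] with y hy hlt
    exact ⟨hy ▸ hlt, hy ▸ hone y⟩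
  -- Coordinate projections pull ℓ-null sets back to ℓ ⊗ ℓ-null sets, so the one-point statements
  -- hold at both coordinates of almost every pair; there the product of intensities is finite and
  -- the subtraction is genuine.
  · have hfst := Measure.quasiMeasurePreserving_fst (μ := ℓ) (ν := ℓ)
    have hsnd := Measure.quasiMeasurePreserving_snd (μ := ℓ) (ν := ℓ)
    filter_upwards [he₂, hae₂, hfst.ae he₁, hsnd.ae he₁, hfst.ae hae₁, hsnd.ae hae₁]
      with p hp hlt e₁ e₂ f₁ f₂
    rw [← hp, ← e₁, ← e₂]
    exact ⟨hlt, hsub _ _ (ENNReal.mul_ne_top f₁.ne f₂.ne)⟩
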